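/- For $n\in\mathbb N$ let $d(x,y)=\frac1\pi\arccos\langle x,y\rangle$ be the normalized geodesic distance on the unit sphere $\mathbb S^n\subset\mathbb R^{n+1}$, and for $K\subset\mathbb S^n$, $r>0$ let $N(K,r)$ be the least number of closed $d$-balls of radius $r$ (with centers in $\mathbb S^n$) needed to cover $K$. Write $\log_+t=\max\{1,\log t\}$ for $t>0$ (and $\log_+0=1$), and $\operatorname{sgn}t=1$ if $t\ge0$, $\operatorname{sgn}t=-1$ if $t<0$. Vectors $\theta_1,\dots,\theta_m\in\mathbb S^n$ induce a tessellation of $K$ with $\delta$-small cells if, for all $x,y\in K$, the equalities $\operatorname{sgn}\langle x,\theta_j\rangle=\operatorname{sgn}\langle y,\theta_j\rangle$ for all $1\le j\le m$ imply $d(x,y)<\delta$. **Corollary.** There are absolute constants $0<c<1<C$ such that the following holds. Let $n\in\mathbb N$, $0<s<n+1$ and $0<\delta<1$ ($s$ real), and put $$K_{n,s}=\{x\in\mathbb R^{n+1}:\ \|x\|_2=1,\ \|x\|_1\le\sqrt s\}.$$ If $m\ge C\,\delta^{-3}\,s\,\log_+\frac ns$ and $\theta_1,\dots,\theta_m$ are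 independent random vectors, each uniformly distributed on $\mathbb S^n$, then with probability at least $1-[2N(K_{n,s},c\delta)]^{-2}$ the vectors $\theta_1,\dots,\theta_m$ induce a tessellation of $K_{n,s}$ with $\delta$-small cells. (If $s<1$, then $K_{n,s}$ is empty and the assertion is trivial.) -/

import Mathlib

open MeasureTheory ProbabilityTheory

noncomputable section

/-- The unit sphere `𝕊ⁿ` of the Euclidean space `ℝ^{n+1}`. -/
abbrev USphere (n : ℕ) : Type :=
  Metric.sphere (0 : EuclideanSpace ℝ (Fin (n + 1))) 1

/-- The geodesic distance on `𝕊ⁿ`, normalized so that antipodal points are at distance `1`. -/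
def geoDist {n : ℕ} (x y : USphere n) : ℝ :=
  Real.arccos (inner ℝ (x : EuclideanSpace ℝ (Fin (n + 1))) y) / Real.pi

/-- The one-bit sign, with values in `{-1, 1}` (and `sgn 0 = 1`). -/
def oneBit (t : ℝ) : ℤ := if 0 ≤ t then 1 else -1

/-- The tessellation of `K` induced by the vectors `θ j` has `δ`-small cells: two points of `K`
with the same one-bit measurements are at geodesic distance less than `δ`. -/
def HasSmallCells {n m : ℕ} (K : Set (USphere n)) (θ : Fin m → USphere n) (δ : ℝ) : Prop :=
  ∀ x ∈ K, ∀ y ∈ K,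
    (∀ j, oneBit (inner ℝ (x : EuclideanSpace ℝ (Fin (n + 1))) (θ j)) =
      oneBit (inner ℝ (y : EuclideanSpace ℝ (Fin (n + 1))) (θ j))) →
    geoDist x y < δ

/-- The metric entropy `N(K, r)`: the least number of (closed) balls of radius `r` of the geodesic
distance that cover `K`. For `r > 0` such a finite cover exists, see `exists_geoCover`. -/
def coverNum {n : ℕ} (K : Set (USphere n)) (r : ℝ) : ℕ :=
  sInf {k : ℕ | ∃ t : Finset (USphere n), t.card = k ∧ ∀ x ∈ K, ∃ z ∈ t, geoDist z x ≤ r}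

theorem exists_geoCover {n : ℕ} (K : Set (USphere n)) {r : ℝ} (hr : 0 < r) :
    ∃ t : Finset (USphere n), ∀ x ∈ K, ∃ z ∈ t, geoDist z x ≤ r := by
  have hopen : ∀ z : USphere n, IsOpen {x : USphere n | geoDist z x < r} := by
    intro z
    refine isOpen_lt ?_ continuous_const
    unfold geoDist
    fun_prop
  have hself : ∀ z : USphere n, geoDist z z = 0 := by
    intro z
    have h : ‖(z : EuclideanSpace ℝ (Fin (n + 1)))‖ = 1 := by simp
    simp [geoDist, h]
  obtain ⟨t, ht⟩ := isCompact_univ.elim_finite_subcover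
    (fun z : USphere n => {x : USphere n | geoDist z x < r}) hopen
    (fun z _ => Set.mem_iUnion.2 ⟨z, by simpa [hself z] using hr⟩)
  refine ⟨t, fun x _ => ?_⟩
  obtain ⟨z, hz, hx⟩ := Set.mem_iUnion₂.1 (ht (Set.mem_univ x))
  exact ⟨z, hz, le_of_lt hx⟩

/-- The convex variant of the sparse vectors: unit vectors whose `ℓ¹` norm is at most `√s`. -/
def convSparse (n : ℕ) (s : ℝ) : Set (USphere n) :=
  {x | ∑ i, |(x : EuclideanSpace ℝ (Fin (n + 1))) i| ≤ Real.sqrt s}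

/-- The truncated logarithm `log₊ t = max (1, log t)`. -/
def logPlus (t : ℝ) : ℝ := max 1 (Real.log t)

/-- The uniform probability measure on `𝕊ⁿ`: normalized surface measure. -/
def sphereUniform (n : ℕ) : Measure (USphere n) :=
  ((volume : Measure (EuclideanSpace ℝ (Fin (n + 1)))).toSphere Set.univ)⁻¹ •
    (volume : Measure (EuclideanSpace ℝ (Fin (n + 1)))).toSphere

end

/-!
Since only the signs of `⟪x, θ j⟫` matter, the uniform vectors may be replaced by independent standard
Gaussian vectors `g j`, whose directions are uniform (`map_direction_stdGaussian`).

Rounding coordinates to multiples of `a ≈ δ² / √s` yields a finite set of representatives of the convex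
sparse vectors, of cardinality `exp (O (D))` with `D = δ⁻² s log₊ (n / s)` (`exists_net_convSparse`).
Here a point `x` and its representative `x₀` satisfy `‖x - x₀‖_∞ ≤ a` and `‖x - x₀‖₁ ≤ 2 √s`, hence
`‖x - x₀‖₂ ≤ δ / 2`. Let `x₀`, `y₀` be two representatives at distance at least `δ`, and let `u`, `v` be
the directions of `x₀ - y₀` and `x₀ + y₀`, which are orthogonal. A vector `g` with `|⟪v, g⟫| ≤ δ / 8` and
`|⟪u, g⟫| ≥ 1 / 2` separates `x₀` from `y₀` with margin `δ / 8` (`inner_mul_inner_neg`). The probability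
of this is of order `δ`, so at least `k ≈ D` of the `m ≈ D / δ` vectors do so, outside an event of
probability `exp (-c δ m)` (`measure_card_lt_le`).

If nevertheless some `x`, `y` in the cells of `x₀`, `y₀` are not separated by any `g j`, then among those
`k` indices `J` one of the differences `z = x - x₀`, `z = y - y₀` satisfies `∑ |⟪z, g j⟫| ≥ k δ / 16`. The
left side equals `⟪z, h⟫` for a signed sum `h = ∑ ± g j`, and the two bounds on `z` force
`∑ i, (|h i| - t)₊` to be large for `t = √(2 k log₊ (n / s))` (`exists_excess_of_not_separated`).
The exponential of this sum is dominated by exponentials of linear functionals (`exp_excess_le`), whose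
moments on the event `|⟪v, g j⟫| ≤ δ / 8` are at most `δ / 8` times the unrestricted ones, by the
Cameron–Martin formula (`lintegral_exp_inner_slab_le`). The resulting factor `δ ^ k` cancels the main part
of the number `choose m k * 2 ^ k ≈ (C / δ) ^ k` of choices of `J` and of the signs. This is what makes
`m ≈ δ⁻³ s log₊ (n / s)` sufficient, with no further power of `log (1 / δ)`. A union bound over the pairs of
representatives concludes (`measure_notSeparated_le`, `measure_notSeparated_le_coverNum`).
-/

/-! ### One-dimensional Gaussian estimates -/

/-- The standard Gaussian density is at most `1 / 2`. -/
theorem gaussianReal_abs_add_le (b η : ℝ) :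
    gaussianReal 0 1 {x | |x + b| ≤ η} ≤ ENNReal.ofReal η := by
  have hset : {x : ℝ | |x + b| ≤ η} = Set.Icc (-b - η) (-b + η) := by
    ext x; simp only [Set.mem_ofPred_eq, abs_le, Set.mem_Icc]
    constructor <;> rintro ⟨h1, h2⟩ <;> constructor <;> linarith
  have hsq : (2 : ℝ) ≤ √(2 * Real.pi) :=
    Real.le_sqrt_of_sq_le (by nlinarith [Real.pi_gt_three])
  rw [gaussianReal_apply _ one_ne_zero, hset]
  calc ∫⁻ x in Set.Icc (-b - η) (-b + η), gaussianPDF 0 1 x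
      ≤ ∫⁻ _ in Set.Icc (-b - η) (-b + η), ENNReal.ofReal (1 / 2) := by
        refine lintegral_mono fun x => ENNReal.ofReal_le_ofReal ?_
        unfold gaussianPDFReal
        calc (√(2 * Real.pi * (1 : NNReal)))⁻¹ * Real.exp (-(x - 0) ^ 2 / (2 * (1 : NNReal)))
            ≤ 2⁻¹ * 1 := by
              gcongr
              · simpa using hsq
              · rw [Real.exp_le_one_iff]
                have := sq_nonneg (x - 0)
                simp only [NNReal.coe_one]
                linarith
          _ = 1 / 2 := by norm_num
    _ = ENNReal.ofReal η := by
        rw [setLIntegral_const, Real.volume_Icc, ← ENNReal.ofReal_mul (by norm_num)]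
        congr 1; ring

/-- The standard Gaussian density is at least `1 / 4` on `[-1/2, 1/2]`. -/
theorem le_gaussianReal_abs_le {η : ℝ} (hη : 0 ≤ η) (hη1 : η ≤ 1 / 2) :
    ENNReal.ofReal (η / 2) ≤ gaussianReal 0 1 {x | |x| ≤ η} := by
  have hset : {x : ℝ | |x| ≤ η} = Set.Icc (-η) η := by
    ext x; simp only [Set.mem_ofPred_eq, abs_le, Set.mem_Icc]
  have hsq : √(2 * Real.pi) ≤ 3 :=
    Real.sqrt_le_iff.2 ⟨by norm_num, by nlinarith [Real.pi_lt_four]⟩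
  have hsq0 : 0 < √(2 * Real.pi) := by positivity
  rw [gaussianReal_apply _ one_ne_zero, hset]
  calc ENNReal.ofReal (η / 2) = ∫⁻ _ in Set.Icc (-η) η, ENNReal.ofReal (1 / 4) := by
        rw [setLIntegral_const, Real.volume_Icc, ← ENNReal.ofReal_mul (by norm_num)]
        congr 1; ring
    _ ≤ ∫⁻ x in Set.Icc (-η) η, gaussianPDF 0 1 x := by
        refine setLIntegral_mono (measurable_gaussianPDF 0 1) fun x hx =>
          ENNReal.ofReal_le_ofReal ?_
        unfold gaussianPDFReal
        calc (1 / 4 : ℝ) ≤ 3⁻¹ * (3 / 4) := by norm_num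
          _ ≤ (√(2 * Real.pi * (1 : NNReal)))⁻¹ * Real.exp (-(x - 0) ^ 2 / (2 * (1 : NNReal))) := by
              gcongr
              · simpa using hsq
              · have h1 : x ^ 2 ≤ 1 / 4 := by
                  have := hx.1; have := hx.2; nlinarith
                have h2 := Real.add_one_le_exp (-(x - 0) ^ 2 / (2 * ((1 : NNReal) : ℝ)))
                simp only [NNReal.coe_one, sub_zero] at h2 ⊢
                linarith

/-! ### The standard Gaussian measure: density, translation and slabs -/

section Gaussian
variable {E : Type*} [NormedAddCommGroup E] [InnerProductSpace ℝ E] [FiniteDimensional ℝ E]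
  [MeasurableSpace E] [BorelSpace E]

/-- Both sides have the same characteristic function. Integrability of the density is
not assumed: it follows from the value of the Fourier integral at `0`, which would be `0` otherwise. -/
theorem stdGaussian_eq_withDensity :
    stdGaussian E = (volume : Measure E).withDensity fun x =>
      ENNReal.ofReal ((2 * Real.pi) ^ (-(Module.finrank ℝ E : ℝ) / 2) * Real.exp (-‖x‖ ^ 2 / 2)) := by
  set κ : ℝ := (2 * Real.pi) ^ (-(Module.finrank ℝ E : ℝ) / 2) with hκ
  have hκ0 : 0 < κ := by positivity
  have key : ∀ t : E, ∫ x : E, Complex.exp (inner ℝ x t * Complex.I) *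
      ((κ * Real.exp (-‖x‖ ^ 2 / 2) : ℝ) : ℂ) = Complex.exp (- ‖t‖ ^ 2 / 2) := by
    intro t
    have h := GaussianFourier.integral_cexp_neg_mul_sq_norm_add (V := E) (b := 1 / 2)
      (by norm_num) Complex.I t
    have h2 : ∀ x : E, Complex.exp (inner ℝ x t * Complex.I) *
      ((κ * Real.exp (-‖x‖ ^ 2 / 2) : ℝ) : ℂ) =
        κ * Complex.exp (-(1/2) * ‖x‖ ^ 2 + Complex.I * inner ℝ t x) := by
      intro x
      rw [real_inner_comm]
      push_cast
      rw [Complex.exp_add]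
      ring_nf
    simp_rw [h2]
    rw [integral_const_mul, h]
    have h3 : (κ : ℂ) * ((Real.pi : ℂ) / (1 / 2)) ^ ((Module.finrank ℝ E : ℂ) / 2) = 1 := by
      have : ((Real.pi : ℂ) / (1 / 2)) ^ ((Module.finrank ℝ E : ℂ) / 2) =
          (((2 * Real.pi) ^ ((Module.finrank ℝ E : ℝ) / 2) : ℝ) : ℂ) := by
        rw [Complex.ofReal_cpow (by positivity)]
        push_cast
        congr 1
        ring
      rw [this, ← Complex.ofReal_mul, hκ, ← Real.rpow_add (by positivity)]
      norm_num
      rw [show -(Module.finrank ℝ E : ℝ) / 2 + (Module.finrank ℝ E : ℝ) / 2 = 0 by ring]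
      simp
    rw [← mul_assoc, h3, one_mul, Complex.I_sq]
    congr 1
    ring
  have hint : Integrable (fun x : E => κ * Real.exp (-‖x‖ ^ 2 / 2)) := by
    by_contra hn
    have h0 := key 0
    simp only [inner_zero_right, Complex.ofReal_zero, zero_mul, Complex.exp_zero, one_mul,
      integral_complex_ofReal] at h0
    rw [integral_undef hn] at h0
    simp at h0
  have : IsFiniteMeasure ((volume : Measure E).withDensity fun x =>
      ENNReal.ofReal (κ * Real.exp (-‖x‖ ^ 2 / 2))) :=
    isFiniteMeasure_withDensity_ofReal hint.2
  refine Measure.ext_of_charFun ?_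
  ext t
  rw [charFun_stdGaussian, charFun_apply, ← key t,
    integral_withDensity_eq_integral_toReal_smul (by fun_prop) (by simp)]
  refine integral_congr_ae (Filter.Eventually.of_forall fun x => ?_)
  simp only
  rw [ENNReal.toReal_ofReal (by positivity), Complex.real_smul, mul_comm]

/-- The Cameron–Martin formula: an exponential tilt of the Gaussian measure is a translation. -/
theorem lintegral_exp_inner_mul_stdGaussian (w : E) {f : E → ENNReal} (hf : Measurable f) :
    ∫⁻ x, ENNReal.ofReal (Real.exp (inner ℝ w x)) * f x ∂(stdGaussian E) =
      ENNReal.ofReal (Real.exp (‖w‖ ^ 2 / 2)) * ∫⁻ x, f (x + w) ∂(stdGaussian E) := by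
  rw [stdGaussian_eq_withDensity]
  set κ : ℝ := (2 * Real.pi) ^ (-(Module.finrank ℝ E : ℝ) / 2) with hκ
  have hκ0 : 0 < κ := by positivity
  rw [lintegral_withDensity_eq_lintegral_mul _ (by fun_prop) (by fun_prop),
    lintegral_withDensity_eq_lintegral_mul _ (by fun_prop) (by fun_prop),
    ← lintegral_const_mul _ (by fun_prop), ← lintegral_add_right_eq_self _ w]
  refine lintegral_congr fun x => ?_
  simp only [Pi.mul_apply]
  rw [← mul_assoc, ← mul_assoc, ← ENNReal.ofReal_mul (by positivity),
    ← ENNReal.ofReal_mul (by positivity)]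
  congr 2
  rw [mul_assoc, mul_left_comm (Real.exp (‖w‖ ^ 2 / 2)), ← Real.exp_add, ← Real.exp_add]
  congr 2
  rw [@norm_add_sq_real, inner_add_right, real_inner_self_eq_norm_sq, real_inner_comm]
  ring

theorem map_inner_stdGaussian {v : E} (hv : ‖v‖ = 1) :
    (stdGaussian E).map (fun x => inner ℝ v x) = gaussianReal 0 1 := by
  have h := (IsGaussian.hasGaussianLaw_id (μ := stdGaussian E)).map (innerSL ℝ v)
  have h2 := h.map_eq_gaussianReal
  have h3 : (innerSL ℝ v ∘ id : E → ℝ) = fun x => inner ℝ v x := by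
    ext x; simp
  have h4 : (fun x => inner ℝ v x) = ⇑(innerSL ℝ v) := by ext x; simp
  rw [h3] at h2
  rw [h2, h4, integral_strongDual_stdGaussian, variance_dual_stdGaussian]
  simp [hv]

theorem indepFun_inner_stdGaussian {u v : E} (huv : inner ℝ u v = 0) :
    IndepFun (fun x : E => inner ℝ u x) (fun x : E => inner ℝ v x) (stdGaussian E) := by
  apply HasGaussianLaw.indepFun_of_covariance_eq_zero
  · exact (IsGaussian.hasGaussianLaw_id (μ := stdGaussian E)).map_fun
      ((innerSL ℝ u).prod (innerSL ℝ v))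
  · have := covarianceBilin_apply_eq_cov (μ := stdGaussian E) (IsGaussian.memLp_two_id) u v
    rw [← this, covarianceBilin_stdGaussian]
    rw [innerSL_apply_apply ℝ, huv]

/-- Exponential moments restricted to a slab of half-width `η` cost a factor `η`: after the
tilt is turned into a translation, what remains is the mass of a translated slab. This estimate keeps
the union bound over the indices in the slab free of a factor `log (1 / η)`. -/
theorem lintegral_exp_inner_slab_le {v : E} (hv : ‖v‖ = 1) (w : E) (η : ℝ) :
    ∫⁻ x, ENNReal.ofReal (Real.exp (inner ℝ w x)) *
        {x : E | |inner ℝ v x| ≤ η}.indicator 1 x ∂(stdGaussian E) ≤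
      ENNReal.ofReal (Real.exp (‖w‖ ^ 2 / 2)) * ENNReal.ofReal η := by
  have hm : MeasurableSet {x : E | |inner ℝ v x| ≤ η} :=
    measurableSet_le (by fun_prop) (by fun_prop)
  rw [lintegral_exp_inner_mul_stdGaussian _ (measurable_one.indicator hm)]
  gcongr
  calc ∫⁻ x, {x : E | |inner ℝ v x| ≤ η}.indicator 1 (x + w) ∂(stdGaussian E)
      = ∫⁻ x, (fun y : ℝ => {y : ℝ | |y + inner ℝ v w| ≤ η}.indicator 1 y)
          (inner ℝ v x) ∂(stdGaussian E) := by
        refine lintegral_congr fun x => ?_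
        simp [Set.indicator, inner_add_right]
    _ = ∫⁻ y, {y : ℝ | |y + inner ℝ v w| ≤ η}.indicator 1 y ∂(gaussianReal 0 1) := by
        rw [← map_inner_stdGaussian hv, lintegral_map _ (by fun_prop)]
        exact measurable_one.indicator (measurableSet_le (by fun_prop) (by fun_prop))
    _ = gaussianReal 0 1 {y : ℝ | |y + inner ℝ v w| ≤ η} :=
        lintegral_indicator_one (measurableSet_le (by fun_prop) (by fun_prop))
    _ ≤ _ := gaussianReal_abs_add_le _ _

/-- A slab of half-width `η`, restricted to vectors with a sizeable component in an orthogonal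
direction, still has mass of order `η`. -/
theorem le_stdGaussian_slab {u v : E} (hu : ‖u‖ = 1) (hv : ‖v‖ = 1) (huv : inner ℝ u v = 0)
    {η : ℝ} (hη : 0 ≤ η) (hη1 : η ≤ 1 / 2) :
    ENNReal.ofReal (η / 4) ≤
      stdGaussian E {x | |inner ℝ v x| ≤ η ∧ 1 / 2 ≤ |inner ℝ u x|} := by
  have hA : MeasurableSet {y : ℝ | |y| ≤ η} := measurableSet_le (by fun_prop) (by fun_prop)
  have hB : MeasurableSet {y : ℝ | 1 / 2 ≤ |y|} := measurableSet_le (by fun_prop) (by fun_prop)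
  have h := (indepFun_inner_stdGaussian huv).symm.measure_inter_preimage_eq_mul _ _ hA hB
  have h1 : stdGaussian E ((fun x => inner ℝ v x) ⁻¹' {y : ℝ | |y| ≤ η}) =
      gaussianReal 0 1 {y : ℝ | |y| ≤ η} := by
    rw [← map_inner_stdGaussian hv, Measure.map_apply (by fun_prop) hA]
  have h2 : stdGaussian E ((fun x => inner ℝ u x) ⁻¹' {y : ℝ | 1 / 2 ≤ |y|}) =
      gaussianReal 0 1 {y : ℝ | 1 / 2 ≤ |y|} := by
    rw [← map_inner_stdGaussian hu, Measure.map_apply (by fun_prop) hB]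
  have h3 : ENNReal.ofReal (1 / 2) ≤ gaussianReal 0 1 {y : ℝ | 1 / 2 ≤ |y|} := by
    have hC : MeasurableSet {y : ℝ | |y + 0| ≤ 1 / 2} :=
      measurableSet_le (by fun_prop) (by fun_prop)
    calc ENNReal.ofReal (1 / 2) = 1 - ENNReal.ofReal (1 / 2) := by
          rw [← ENNReal.ofReal_one, ← ENNReal.ofReal_sub _ (by norm_num)]; norm_num
      _ ≤ 1 - gaussianReal 0 1 {y : ℝ | |y + 0| ≤ 1 / 2} :=
          tsub_le_tsub_left (gaussianReal_abs_add_le 0 _) _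
      _ = gaussianReal 0 1 {y : ℝ | |y + 0| ≤ 1 / 2}ᶜ := (prob_compl_eq_one_sub hC).symm
      _ ≤ _ := measure_mono fun y hy => by
          simp only [Set.mem_compl_iff, Set.mem_ofPred_eq, add_zero, not_le] at hy ⊢
          exact hy.le
  change _ ≤ stdGaussian E ((fun x => inner ℝ v x) ⁻¹' {y : ℝ | |y| ≤ η} ∩
    (fun x => inner ℝ u x) ⁻¹' {y : ℝ | 1 / 2 ≤ |y|})
  rw [h, h1, h2, show η / 4 = η / 2 * (1 / 2) by ring, ENNReal.ofReal_mul (by positivity)]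
  exact mul_le_mul' (le_gaussianReal_abs_le hη hη1) h3

end Gaussian

/-! ### The direction of a Gaussian vector is uniform on the sphere -/

section Direction
variable {n : ℕ}

/-- The direction `x / ‖x‖` of a vector; the value at `0` is an arbitrary point of the sphere. -/
noncomputable def direction (x : EuclideanSpace ℝ (Fin (n + 1))) : USphere n :=
  open Classical in
  ⟨if x = 0 then EuclideanSpace.single 0 1 else ‖x‖⁻¹ • x, by
    split_ifs with h
    · simp
    · simp [norm_smul, h]⟩

theorem coe_direction {x : EuclideanSpace ℝ (Fin (n + 1))} (hx : x ≠ 0) :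
    (direction x : EuclideanSpace ℝ (Fin (n + 1))) = ‖x‖⁻¹ • x := by
  simp [direction, hx]

theorem measurable_direction :
    Measurable (direction : EuclideanSpace ℝ (Fin (n + 1)) → USphere n) := by
  refine Measurable.subtype_mk (Measurable.ite (measurableSet_singleton _) ?_ ?_) <;> fun_prop

/-- In polar coordinates the Gaussian measure is a product of the surface measure and a
radial measure, whose mass is forced by normalization. -/
theorem map_direction_stdGaussian :
    (stdGaussian (EuclideanSpace ℝ (Fin (n + 1)))).map direction = sphereUniform n := by
  set E := EuclideanSpace ℝ (Fin (n + 1))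
  set F : ℝ → ENNReal := fun r => ENNReal.ofReal
    ((2 * Real.pi) ^ (-(Module.finrank ℝ E : ℝ) / 2) * Real.exp (-r ^ 2 / 2)) with hF
  have hFm : Measurable F := by fun_prop
  set I : ENNReal := ∫⁻ r : Set.Ioi (0 : ℝ), F r
    ∂(Measure.volumeIoiPow (Module.finrank ℝ E - 1)) with hI
  have key : ∀ A : Set (USphere n), MeasurableSet A →
      (stdGaussian E).map direction A = (volume : Measure E).toSphere A * I := by
    intro A hA
    have hpre := measurable_direction hA
    rw [Measure.map_apply measurable_direction hA, stdGaussian_eq_withDensity,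
      withDensity_apply _ hpre, ← lintegral_indicator hpre]
    have hae : ((volume : Measure E).restrict {0}ᶜ) = volume := by
      refine Measure.restrict_eq_self_of_ae_mem ?_
      exact Measure.ae_ne _ 0
    conv_lhs => rw [← hae]
    rw [← lintegral_subtype_comap (measurableSet_singleton _).compl]
    have hmp := (volume : Measure E).measurePreserving_homeomorphUnitSphereProd
    have : ∀ x : ({0}ᶜ : Set E), (direction ⁻¹' A).indicator (fun x : E => F ‖x‖) (x : E) =
        (fun q : USphere n × Set.Ioi (0 : ℝ) => A.indicator 1 q.1 * F q.2)
          (homeomorphUnitSphereProd E x) := by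
      intro x
      have hx : (x : E) ≠ 0 := x.2
      have hd : direction (x : E) = (homeomorphUnitSphereProd E x).1 := by
        ext1
        rw [coe_direction hx, homeomorphUnitSphereProd_apply_fst_coe]
      by_cases hxA : direction (x : E) ∈ A
      · rw [Set.indicator_of_mem (show (x : E) ∈ direction ⁻¹' A from hxA)]
        simp only
        rw [Set.indicator_of_mem (hd ▸ hxA)]
        simp
      · rw [Set.indicator_of_notMem (show (x : E) ∉ direction ⁻¹' A from hxA)]
        simp only
        rw [Set.indicator_of_notMem (hd ▸ hxA), zero_mul]
    change ∫⁻ x : ({0}ᶜ : Set E), (direction ⁻¹' A).indicator (fun x : E => F ‖x‖) (x : E)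
      ∂_ = _
    refine (lintegral_congr this).trans ((hmp.lintegral_comp
      (((measurable_one.indicator hA).comp measurable_fst).mul
        (hFm.comp (measurable_subtype_coe.comp measurable_snd)))).trans ?_)
    refine (lintegral_prod_mul (measurable_one.indicator hA).aemeasurable
      (hFm.comp measurable_subtype_coe).aemeasurable).trans ?_
    rw [lintegral_indicator_one hA]
    rfl
  have h1 := key Set.univ MeasurableSet.univ
  have : IsProbabilityMeasure ((stdGaussian E).map direction) :=
    Measure.isProbabilityMeasure_map measurable_direction.aemeasurable
  rw [measure_univ] at h1
  ext A hA
  rw [key A hA, sphereUniform, Measure.smul_apply, smul_eq_mul, mul_comm,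
    ENNReal.eq_inv_of_mul_eq_one_left ((mul_comm I _).trans h1.symm)]

end Direction

/-! ### A net of cells of the convex sparse vectors -/

theorem sum_pow_natAbs_le {r : ℝ} (hr0 : 0 ≤ r) (hr : r ≤ 1 / 2) (s : Finset ℤ) :
    ∑ j ∈ s, r ^ j.natAbs ≤ 1 + 4 * r := by
  have hg := hasSum_geometric_of_lt_one hr0 (by linarith : r < 1)
  have h1 : HasSum (fun n : ℕ => r ^ (n : ℤ).natAbs) (1 - r)⁻¹ := by simpa using hg
  have h2 : HasSum (fun n : ℕ => r ^ (-((n : ℤ) + 1)).natAbs) (r * (1 - r)⁻¹) := by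
    have : ∀ n : ℕ, (-((n : ℤ) + 1)).natAbs = n + 1 := fun n => by omega
    simp_rw [this, pow_succ']
    exact hg.mul_left r
  have h := HasSum.of_nat_of_neg_add_one (f := fun j : ℤ => r ^ j.natAbs) h1 h2
  refine (sum_le_hasSum s (fun _ _ => by positivity) h).trans ?_
  rw [← one_add_mul, ← div_eq_mul_inv, div_le_iff₀ (by linarith)]
  nlinarith

/-- The number of integer points of `ℓ¹` norm at most `R`, estimated through the generating
function of the `ℓ¹` norm at `exp (-l)`. -/
theorem card_filter_sum_natAbs_le {ι : Type*} [Fintype ι] [DecidableEq ι] (B : ι → Finset ℤ)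
    {l R : ℝ} (hl : 1 ≤ l) :
    (((Fintype.piFinset B).filter fun q => ∑ i, ((q i).natAbs : ℝ) ≤ R).card : ℝ) ≤
      Real.exp (l * R + 4 * Fintype.card ι * Real.exp (-l)) := by
  set Q := (Fintype.piFinset B).filter fun q => ∑ i, ((q i).natAbs : ℝ) ≤ R
  have hr : Real.exp (-l) ≤ 1 / 2 := by
    rw [Real.exp_neg, one_div]
    exact inv_anti₀ (by norm_num) (by linarith [Real.add_one_le_exp l])
  have hpow : ∀ j : ℤ, Real.exp (-l) ^ j.natAbs = Real.exp (-(l * (j.natAbs : ℝ))) := fun j => by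
    rw [← Real.exp_nat_mul]; ring_nf
  have h1 : (Q.card : ℝ) * Real.exp (-(l * R)) ≤
      ∑ q ∈ Q, ∏ i, Real.exp (-l) ^ (q i).natAbs := by
    rw [← nsmul_eq_mul]
    refine Finset.card_nsmul_le_sum _ _ _ fun q hq => ?_
    simp_rw [hpow]
    rw [← Real.exp_sum, Finset.sum_neg_distrib, ← Finset.mul_sum]
    gcongr
    exact (Finset.mem_filter.1 hq).2
  have h2 : ∑ q ∈ Q, ∏ i, Real.exp (-l) ^ (q i).natAbs ≤
      ∏ i : ι, ∑ j ∈ B i, Real.exp (-l) ^ j.natAbs := by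
    rw [Finset.prod_univ_sum]
    exact Finset.sum_le_sum_of_subset_of_nonneg (Finset.filter_subset _ _)
      fun _ _ _ => by positivity
  have h3 : ∏ i : ι, ∑ j ∈ B i, Real.exp (-l) ^ j.natAbs ≤
      Real.exp (4 * Fintype.card ι * Real.exp (-l)) := by
    calc ∏ i : ι, ∑ j ∈ B i, Real.exp (-l) ^ j.natAbs
        ≤ ∏ _i : ι, Real.exp (4 * Real.exp (-l)) := by
          refine Finset.prod_le_prod (fun _ _ => by positivity) fun i _ => ?_
          refine (sum_pow_natAbs_le (by positivity) hr _).trans ?_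
          linarith [Real.add_one_le_exp (4 * Real.exp (-l))]
      _ = _ := by
          rw [Finset.prod_const, ← Real.exp_nat_mul, Finset.card_univ]
          ring_nf
  calc (Q.card : ℝ) = Q.card * Real.exp (-(l * R)) * Real.exp (l * R) := by
        rw [mul_assoc, ← Real.exp_add]; simp
    _ ≤ Real.exp (4 * Fintype.card ι * Real.exp (-l)) * Real.exp (l * R) := by
        gcongr; exact h1.trans (h2.trans h3)
    _ = _ := by rw [← Real.exp_add, add_comm]

theorem natAbs_round_le (r : ℝ) : ((round r).natAbs : ℝ) ≤ 2 * |r| := by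
  rw [Nat.cast_natAbs, Int.cast_abs]
  by_cases h : round r = 0
  · simp [h]
  · have h1 : (1 : ℝ) ≤ |(round r : ℝ)| := by exact_mod_cast Int.one_le_abs h
    have h2 := abs_sub_round r
    have h3 : |(round r : ℝ)| ≤ |r| + |r - round r| := by
      calc |(round r : ℝ)| = |r - (r - round r)| := by ring_nf
        _ ≤ _ := abs_sub _ _
    linarith

/-- Rounding the coordinates to multiples of `a` partitions the convex sparse vectors into
cells of `ℓ^∞` diameter at most `a`, indexed by integer points of `ℓ¹` norm at most `2 √s / a`; `X`
holds one point of each nonempty cell. -/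
theorem exists_net_convSparse (n : ℕ) (s : ℝ) {a l : ℝ} (ha : 0 < a) (hl : 1 ≤ l) :
    ∃ X : Finset (USphere n), (∀ x ∈ X, x ∈ convSparse n s) ∧
      (X.card : ℝ) ≤ Real.exp (l * (2 * √s / a) + 4 * (n + 1) * Real.exp (-l)) ∧
      ∀ x ∈ convSparse n s, ∃ x₀ ∈ X,
        ∀ i, |(x : EuclideanSpace ℝ (Fin (n + 1))) i - (x₀ : EuclideanSpace ℝ (Fin (n + 1))) i|
          ≤ a := by
  set q : USphere n → Fin (n + 1) → ℤ :=
    fun x i => round ((x : EuclideanSpace ℝ (Fin (n + 1))) i / a) with hq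
  set N : ℤ := ⌈2 * √s / a⌉
  set Q := (Fintype.piFinset fun _ : Fin (n + 1) => Finset.Icc (-N) N).filter
    fun q => ∑ i, ((q i).natAbs : ℝ) ≤ 2 * √s / a with hQ
  have hqQ : ∀ x ∈ convSparse n s, q x ∈ Q := by
    intro x hx
    have hsum : ∑ i, ((q x i).natAbs : ℝ) ≤ 2 * √s / a := by
      calc ∑ i, ((q x i).natAbs : ℝ)
          ≤ ∑ i, 2 / a * |(x : EuclideanSpace ℝ (Fin (n + 1))) i| := by
            refine Finset.sum_le_sum fun i _ => (natAbs_round_le _).trans (le_of_eq ?_)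
            rw [abs_div, abs_of_pos ha]; ring
        _ ≤ 2 / a * √s := by
            rw [← Finset.mul_sum]
            gcongr
            exact hx
        _ = _ := by ring
    refine Finset.mem_filter.2 ⟨Fintype.mem_piFinset.2 fun i => ?_, hsum⟩
    have h1 : ((q x i).natAbs : ℝ) ≤ N :=
      ((Finset.single_le_sum (f := fun i => ((q x i).natAbs : ℝ)) (fun _ _ => by positivity)
        (Finset.mem_univ i)).trans hsum).trans (Int.le_ceil _)
    rw [Nat.cast_natAbs] at h1
    have h2 : |q x i| ≤ N := by exact_mod_cast h1
    exact Finset.mem_Icc.2 (abs_le.1 h2)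
  obtain ⟨X, hXK, hX⟩ := (convSparse n s).exists_subset_bijOn q
  have himg : q '' convSparse n s ⊆ Q := by
    rintro _ ⟨x, hx, rfl⟩; exact hqQ x hx
  have hfin : X.Finite := by
    refine Set.Finite.of_finite_image ?_ hX.injOn
    rw [hX.image_eq]
    exact Q.finite_toSet.subset himg
  refine ⟨hfin.toFinset, fun x hx => hXK (hfin.mem_toFinset.1 hx), ?_, ?_⟩
  · have hcard : hfin.toFinset.card ≤ Q.card :=
      Finset.card_le_card_of_injOn q (fun x hx => hqQ x (hXK (by simpa using hx)))
        (by simpa using hX.injOn)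
    have := card_filter_sum_natAbs_le (fun _ : Fin (n + 1) => Finset.Icc (-N) N)
      (R := 2 * √s / a) hl
    rw [Fintype.card_fin, Nat.cast_add, Nat.cast_one] at this
    exact (Nat.cast_le.2 hcard).trans this
  · intro x hx
    obtain ⟨x₀, hx₀, he⟩ := hX.surjOn ⟨x, hx, rfl⟩
    refine ⟨x₀, hfin.mem_toFinset.2 hx₀, fun i => ?_⟩
    set b := (x : EuclideanSpace ℝ (Fin (n + 1))) i
    set b₀ := (x₀ : EuclideanSpace ℝ (Fin (n + 1))) i
    have hi : round (b₀ / a) = round (b / a) := congrFun he i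
    have h1 := abs_sub_round (b / a)
    have h2 := abs_sub_round (b₀ / a)
    rw [hi] at h2
    have h3 : |b / a - b₀ / a| ≤ 1 := by
      rw [abs_le] at h1 h2 ⊢
      constructor <;> linarith [h1.1, h1.2, h2.1, h2.2]
    rwa [← sub_div, abs_div, abs_of_pos ha, div_le_one ha] at h3

theorem sq_norm_le_of_abs_le {d : ℕ} {z : EuclideanSpace ℝ (Fin d)} {a b : ℝ}
    (hz : ∀ i, |z i| ≤ a) (hb : ∑ i, |z i| ≤ b) (ha : 0 ≤ a) : ‖z‖ ^ 2 ≤ a * b := by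
  rw [EuclideanSpace.real_norm_sq_eq]
  calc ∑ i, z i ^ 2 ≤ ∑ i, a * |z i| := by
        refine Finset.sum_le_sum fun i _ => ?_
        rw [← sq_abs, sq]
        exact mul_le_mul_of_nonneg_right (hz i) (abs_nonneg _)
    _ ≤ a * b := by rw [← Finset.mul_sum]; gcongr

theorem sum_abs_sub_le {n : ℕ} {s : ℝ} {x y : USphere n} (hx : x ∈ convSparse n s)
    (hy : y ∈ convSparse n s) :
    ∑ i, |((x : EuclideanSpace ℝ (Fin (n + 1))) - y) i| ≤ 2 * √s := by
  calc ∑ i, |((x : EuclideanSpace ℝ (Fin (n + 1))) - y) i|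
      ≤ ∑ i, (|(x : EuclideanSpace ℝ (Fin (n + 1))) i| +
          |(y : EuclideanSpace ℝ (Fin (n + 1))) i|) :=
        Finset.sum_le_sum fun i _ => abs_sub _ _
    _ ≤ √s + √s := by rw [Finset.sum_add_distrib]; exact add_le_add hx hy
    _ = _ := by ring

/-- A chord of the unit sphere is at least `2 / π` times its angle. -/
theorem two_mul_geoDist_le {n : ℕ} (x y : USphere n) :
    2 * geoDist x y ≤ ‖(x : EuclideanSpace ℝ (Fin (n + 1))) - y‖ := by
  have hx : ‖(x : EuclideanSpace ℝ (Fin (n + 1)))‖ = 1 := by simp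
  have hy : ‖(y : EuclideanSpace ℝ (Fin (n + 1)))‖ = 1 := by simp
  have hin := abs_real_inner_le_norm (x : EuclideanSpace ℝ (Fin (n + 1))) y
  rw [hx, hy, mul_one, abs_le] at hin
  have hc := Real.cos_le_one_sub_mul_cos_sq (x := Real.arccos
    (inner ℝ (x : EuclideanSpace ℝ (Fin (n + 1))) y))
    (by rw [abs_of_nonneg (Real.arccos_nonneg _)]; exact Real.arccos_le_pi _)
  rw [Real.cos_arccos hin.1 hin.2] at hc
  refine abs_le_of_sq_le_sq' ?_ (norm_nonneg _) |>.2
  rw [@norm_sub_sq_real, hx, hy, geoDist, mul_pow, div_pow]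
  have : 2 / Real.pi ^ 2 * Real.arccos (inner ℝ (x : EuclideanSpace ℝ (Fin (n + 1))) y) ^ 2 =
    2 * (Real.arccos (inner ℝ (x : EuclideanSpace ℝ (Fin (n + 1))) y) ^ 2 / Real.pi ^ 2) := by ring
  linarith

theorem coverNum_le_card {n : ℕ} {K : Set (USphere n)} {r : ℝ} {X : Finset (USphere n)}
    (hX : ∀ x ∈ K, ∃ z ∈ X, ‖(x : EuclideanSpace ℝ (Fin (n + 1))) - z‖ ≤ 2 * r) :
    coverNum K r ≤ X.card := by
  refine Nat.sInf_le ⟨X, rfl, fun x hx => ?_⟩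
  obtain ⟨z, hz, h⟩ := hX x hx
  refine ⟨z, hz, ?_⟩
  have := two_mul_geoDist_le z x
  rw [norm_sub_rev] at this
  linarith

/-! ### Robust separation of two points -/

section Separation
variable {E : Type*} [NormedAddCommGroup E] [InnerProductSpace ℝ E]

/-- The sum and the difference of two unit vectors are orthogonal. When the points are
antipodal the sum vanishes and `v` is any unit vector orthogonal to the chord, which needs dimension
at least two. -/
theorem exists_orthonormal_chord_frame [FiniteDimensional ℝ E] (hE : 2 ≤ Module.finrank ℝ E)
    {x y : E} (hx : ‖x‖ = 1) (hy : ‖y‖ = 1) (hxy : x ≠ y) :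
    ∃ u v : E, ‖u‖ = 1 ∧ ‖v‖ = 1 ∧ inner ℝ u v = 0 ∧ x - y = ‖x - y‖ • u ∧
      x + y = ‖x + y‖ • v := by
  have hp : ‖x - y‖ ≠ 0 := by rwa [norm_ne_zero_iff, sub_ne_zero]
  have hpq : inner ℝ (x - y) (x + y) = 0 := by
    rw [inner_sub_left, inner_add_right, inner_add_right, real_inner_self_eq_norm_sq,
      real_inner_self_eq_norm_sq, hx, hy, real_inner_comm]
    ring
  have hu : ‖(‖x - y‖⁻¹ • (x - y))‖ = 1 := by
    rw [norm_smul, norm_inv, norm_norm, inv_mul_cancel₀ hp]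
  by_cases hq : x + y = 0
  · have hlt : Module.finrank ℝ (ℝ ∙ (x - y)) < Module.finrank ℝ E :=
      (finrank_span_singleton (sub_ne_zero.2 hxy)).trans_lt (by omega)
    have hne : (ℝ ∙ (x - y))ᗮ ≠ ⊥ := by
      intro h
      rw [Submodule.orthogonal_eq_bot_iff] at h
      rw [h, finrank_top] at hlt
      exact lt_irrefl _ hlt
    obtain ⟨w, hw, hw0⟩ := Submodule.exists_mem_ne_zero_of_ne_bot hne
    have hw1 : ‖w‖ ≠ 0 := norm_ne_zero_iff.2 hw0
    refine ⟨_, ‖w‖⁻¹ • w, hu, ?_, ?_, ?_, ?_⟩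
    · rw [norm_smul, norm_inv, norm_norm, inv_mul_cancel₀ hw1]
    · rw [inner_smul_left, inner_smul_right, Submodule.mem_orthogonal_singleton_iff_inner_right.1 hw]
      simp
    · rw [smul_inv_smul₀ hp]
    · simp [hq]
  · have hq1 : ‖x + y‖ ≠ 0 := norm_ne_zero_iff.2 hq
    refine ⟨_, ‖x + y‖⁻¹ • (x + y), hu, ?_, ?_, ?_, ?_⟩
    · rw [norm_smul, norm_inv, norm_norm, inv_mul_cancel₀ hq1]
    · rw [inner_smul_left, inner_smul_right, hpq]
      simp
    · rw [smul_inv_smul₀ hp]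
    · rw [smul_inv_smul₀ hq1]

/-- If `g` has a sizeable component along the chord `x₀ - y₀` and a small one along
`x₀ + y₀`, then it separates `x₀` and `y₀` with margin `δ / 8`, hence also all points whose inner
products with `g` are within that margin. -/
theorem inner_mul_inner_neg {x₀ y₀ u v g x y : E} {δ : ℝ} (hx₀ : ‖x₀‖ = 1) (hy₀ : ‖y₀‖ = 1)
    (hu : x₀ - y₀ = ‖x₀ - y₀‖ • u) (hv : x₀ + y₀ = ‖x₀ + y₀‖ • v)
    (hδ : δ ≤ ‖x₀ - y₀‖) (hvg : |inner ℝ v g| ≤ δ / 8) (hug : 1 / 2 ≤ |inner ℝ u g|)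
    (hx : |inner ℝ (x - x₀) g| < δ / 8) (hy : |inner ℝ (y - y₀) g| < δ / 8) :
    inner ℝ x g * inner ℝ y g < 0 := by
  have hA : inner ℝ x₀ g - inner ℝ y₀ g = ‖x₀ - y₀‖ * inner ℝ u g := by
    rw [← inner_sub_left]
    conv_lhs => rw [hu]
    rw [real_inner_smul_left]
  have hB : inner ℝ x₀ g + inner ℝ y₀ g = ‖x₀ + y₀‖ * inner ℝ v g := by
    rw [← inner_add_left]
    conv_lhs => rw [hv]
    rw [real_inner_smul_left]
  have hδ0 : 0 < δ := by linarith [abs_nonneg (inner ℝ (x - x₀) g)]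
  have hB1 : |inner ℝ x₀ g + inner ℝ y₀ g| ≤ δ / 4 := by
    rw [hB, abs_mul, abs_norm]
    have : ‖x₀ + y₀‖ ≤ 2 := (norm_add_le _ _).trans (by rw [hx₀, hy₀]; norm_num)
    calc ‖x₀ + y₀‖ * |inner ℝ v g| ≤ 2 * (δ / 8) := by gcongr
      _ = δ / 4 := by ring
  have hA1 : δ / 2 ≤ |inner ℝ x₀ g - inner ℝ y₀ g| := by
    rw [hA, abs_mul, abs_norm]
    calc δ / 2 = δ * (1 / 2) := by ring
      _ ≤ ‖x₀ - y₀‖ * |inner ℝ u g| := by gcongr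
  rw [inner_sub_left, abs_lt] at hx hy
  rw [abs_le] at hB1
  rcases le_abs.1 hA1 with h | h
  · exact mul_neg_of_pos_of_neg (by linarith [hB1.1, hx.1]) (by linarith [hB1.2, hy.2])
  · exact mul_neg_of_neg_of_pos (by linarith [hB1.2, hx.2]) (by linarith [hB1.1, hy.1])

/-- The sum of `g j` over `j ∈ J`, with sign `+` for `j ∈ A` and `-` for the other `j`. -/
noncomputable def signedSum {ι : Type*} [DecidableEq ι] (J A : Finset ι) (g : ι → E) : E :=
  ∑ j ∈ J, (if j ∈ A then (1 : ℝ) else -1) • g j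

/-- The sum of the absolute inner products is attained by a signed sum of the vectors. -/
theorem exists_signedSum_eq {ι : Type*} [DecidableEq ι] (J : Finset ι) (g : ι → E) (z : E) :
    ∃ A ⊆ J, inner ℝ z (signedSum J A g) = ∑ j ∈ J, |inner ℝ z (g j)| := by
  refine ⟨J.filter fun j => 0 ≤ inner ℝ z (g j), Finset.filter_subset _ _, ?_⟩
  rw [signedSum, inner_sum]
  refine Finset.sum_congr rfl fun j hj => ?_
  rw [inner_smul_right]
  by_cases h : 0 ≤ inner ℝ z (g j)
  · simp [h, hj, abs_of_nonneg h]
  · simp [h, abs_of_neg (not_le.1 h)]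

/-- Duality for the intersection of an `ℓ¹` ball and an `ℓ^∞` ball: the part of `h` below
the level `t` is paired with the `ℓ¹` norm of `z`, the excess over `t` with its `ℓ^∞` norm. -/
theorem inner_le_add_excess {d : ℕ} {z h : EuclideanSpace ℝ (Fin d)} {a b t : ℝ}
    (hz : ∀ i, |z i| ≤ a) (hb : ∑ i, |z i| ≤ b) (ht : 0 ≤ t) :
    inner ℝ z h ≤ b * t + a * ∑ i, max (|h i| - t) 0 := by
  calc inner ℝ z h = ∑ i, h i * z i := by simp [PiLp.inner_apply]
    _ ≤ ∑ i, (|z i| * t + a * max (|h i| - t) 0) := by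
        refine Finset.sum_le_sum fun i _ => ?_
        calc h i * z i ≤ |h i| * |z i| := by rw [← abs_mul]; exact le_abs_self _
          _ ≤ (t + max (|h i| - t) 0) * |z i| := by
              gcongr; linarith [le_max_left (|h i| - t) 0]
          _ = |z i| * t + |z i| * max (|h i| - t) 0 := by ring
          _ ≤ _ := by gcongr; exact hz i
    _ ≤ _ := by
        rw [Finset.sum_add_distrib, ← Finset.sum_mul, ← Finset.mul_sum]
        gcongr

/-- If `x` and `y`, in the cells of `x₀` and `y₀`, are separated by no `g j`, then on the
indices `J` that separate `x₀` and `y₀` robustly one of `x - x₀`, `y - y₀` has a large average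
`|⟪z, g j⟫|`; by duality some signed sum of the `g j` then has large coordinates. The conclusion no
longer mentions `x` and `y`. -/
theorem exists_excess_of_not_separated {d : ℕ} {ι : Type*} [DecidableEq ι] {J : Finset ι}
    {g : ι → EuclideanSpace ℝ (Fin d)} {x₀ y₀ u v x y : EuclideanSpace ℝ (Fin d)} {δ a b t : ℝ}
    (hx₀ : ‖x₀‖ = 1) (hy₀ : ‖y₀‖ = 1)
    (hu : x₀ - y₀ = ‖x₀ - y₀‖ • u) (hv : x₀ + y₀ = ‖x₀ + y₀‖ • v) (hδ : δ ≤ ‖x₀ - y₀‖)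
    (hJ : ∀ j ∈ J, |inner ℝ v (g j)| ≤ δ / 8 ∧ 1 / 2 ≤ |inner ℝ u (g j)|)
    (hxy : ∀ j, 0 ≤ inner ℝ x (g j) * inner ℝ y (g j))
    (hx : ∀ i, |(x - x₀) i| ≤ a) (hxb : ∑ i, |(x - x₀) i| ≤ b)
    (hy : ∀ i, |(y - y₀) i| ≤ a) (hyb : ∑ i, |(y - y₀) i| ≤ b)
    (ht : 0 ≤ t) (hbt : b * t ≤ J.card * δ / 32) :
    ∃ A ⊆ J, J.card * δ / 32 ≤ a * ∑ i, max (|signedSum J A g i| - t) 0 := by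
  have hsum : J.card * (δ / 8) ≤
      ∑ j ∈ J, |inner ℝ (x - x₀) (g j)| + ∑ j ∈ J, |inner ℝ (y - y₀) (g j)| := by
    rw [← Finset.sum_add_distrib, ← nsmul_eq_mul]
    refine Finset.card_nsmul_le_sum _ _ _ fun j hj => ?_
    by_contra! hlt
    have h1 := abs_nonneg (inner ℝ (x - x₀) (g j))
    have h2 := abs_nonneg (inner ℝ (y - y₀) (g j))
    exact absurd (hxy j) (not_le.2 (inner_mul_inner_neg hx₀ hy₀ hu hv hδ (hJ j hj).1 (hJ j hj).2
      (by linarith) (by linarith)))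
  have main : ∀ z : EuclideanSpace ℝ (Fin d), (∀ i, |z i| ≤ a) → ∑ i, |z i| ≤ b →
      J.card * δ / 16 ≤ ∑ j ∈ J, |inner ℝ z (g j)| →
      ∃ A ⊆ J, J.card * δ / 32 ≤ a * ∑ i, max (|signedSum J A g i| - t) 0 := by
    intro z hz hzb hle
    obtain ⟨A, hA, he⟩ := exists_signedSum_eq J g z
    have := inner_le_add_excess (h := signedSum J A g) hz hzb ht
    exact ⟨A, hA, by linarith⟩
  rcases le_total (∑ j ∈ J, |inner ℝ (x - x₀) (g j)|) (∑ j ∈ J, |inner ℝ (y - y₀) (g j)|) with h | h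
  · exact main _ hy hyb (by linarith)
  · exact main _ hx hxb (by linarith)

end Separation

/-! ### Deviation inequalities for independent Gaussian vectors -/

section Deviation

/-- Fubini for a product of functions of distinct coordinates, over a subset of the indices. -/
theorem lintegral_prod_pi {ι α : Type*} [Fintype ι] [MeasurableSpace α] {γ : Measure α}
    [IsProbabilityMeasure γ] (J : Finset ι) {f : ι → α → ENNReal} (hf : ∀ j, Measurable (f j)) :
    ∫⁻ g, ∏ j ∈ J, f j (g j) ∂(Measure.pi fun _ : ι => γ) = ∏ j ∈ J, ∫⁻ x, f j x ∂γ := by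
  have hind : iIndepFun (fun (j : ι) (g : ι → α) => f j (g j)) (Measure.pi fun _ : ι => γ) :=
    iIndepFun_pi fun j => (hf j).aemeasurable
  rw [lintegral_prod_eq_prod_lintegral_of_indepFun J _ hind
    fun j => (hf j).comp (measurable_pi_apply j)]
  refine Finset.prod_congr rfl fun j _ => ?_
  exact (measurePreserving_eval (fun _ : ι => γ) j).lintegral_comp (hf j)

theorem measure_le_lintegral_of_one_le {α : Type*} [MeasurableSpace α] {μ : Measure α} {s : Set α}
    {f : α → ENNReal} (hf : AEMeasurable f μ) (h : ∀ x ∈ s, 1 ≤ f x) : μ s ≤ ∫⁻ x, f x ∂μ := by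
  calc μ s ≤ 1 * μ {x | 1 ≤ f x} := by rw [one_mul]; exact measure_mono h
    _ ≤ _ := mul_meas_ge_le_lintegral₀ hf 1

/-- A Chernoff bound: it is unlikely that fewer than `k` of the samples fall into a set of
mass at least `p` when `k` is well below the expected number. -/
theorem measure_card_lt_le {ι α : Type*} [Fintype ι] [MeasurableSpace α] {γ : Measure α}
    [IsProbabilityMeasure γ] {S : Set α} [DecidablePred (· ∈ S)] (hS : MeasurableSet S) {p : ℝ}
    (hp : ENNReal.ofReal p ≤ γ S) (k : ℕ) :
    (Measure.pi fun _ : ι => γ)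
      {g | (Finset.univ.filter fun j => g j ∈ S).card < k} ≤
      ENNReal.ofReal (Real.exp (k - p * Fintype.card ι / 2)) := by
  set F : α → ENNReal := fun x => S.indicator (fun _ => ENNReal.ofReal (Real.exp (-1))) x +
    Sᶜ.indicator 1 x with hF
  have hFm : Measurable F :=
    (measurable_const.indicator hS).add (measurable_one.indicator hS.compl)
  have hint : ∫⁻ x, F x ∂γ ≤ ENNReal.ofReal (Real.exp (-p / 2)) := by
    rw [hF, lintegral_add_left (measurable_const.indicator hS),
      lintegral_indicator_const hS, lintegral_indicator_one hS.compl, prob_compl_eq_one_sub hS]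
    have hq : γ S = ENNReal.ofReal (γ.real S) := (ofReal_measureReal).symm
    have hpq : p ≤ γ.real S := by
      rw [hq] at hp
      exact (ENNReal.ofReal_le_ofReal_iff measureReal_nonneg).1 hp
    have hq1 : γ.real S ≤ 1 := measureReal_le_one
    rw [hq, ← ENNReal.ofReal_one, ← ENNReal.ofReal_sub _ measureReal_nonneg,
      ← ENNReal.ofReal_mul (Real.exp_pos _).le, ← ENNReal.ofReal_add (by positivity) (by linarith)]
    refine ENNReal.ofReal_le_ofReal ?_
    have he : Real.exp (-1) ≤ 1 / 2 := by
      rw [Real.exp_neg, one_div]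
      exact inv_anti₀ (by norm_num) (by linarith [Real.add_one_le_exp 1])
    have := Real.add_one_le_exp (-p / 2)
    nlinarith [measureReal_nonneg (μ := γ) (s := S)]
  have hFv : ∀ x, F x = if x ∈ S then ENNReal.ofReal (Real.exp (-1)) else 1 := by
    intro x
    by_cases h : x ∈ S <;> simp [hF, h]
  clear_value F
  have hPm : Measurable fun g : ι → α => ∏ j, F (g j) :=
    Finset.measurable_prod _ fun j _ => hFm.comp (measurable_pi_apply j)
  calc (Measure.pi fun _ : ι => γ) {g | (Finset.univ.filter fun j => g j ∈ S).card < k}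
      ≤ ∫⁻ g, ENNReal.ofReal (Real.exp k) * ∏ j, F (g j) ∂(Measure.pi fun _ : ι => γ) := by
        refine measure_le_lintegral_of_one_le (hPm.const_mul _).aemeasurable fun g hg => ?_
        simp_rw [hFv]
        rw [Finset.prod_ite, Finset.prod_const, Finset.prod_const_one, mul_one,
          ← ENNReal.ofReal_pow (Real.exp_pos _).le, ← ENNReal.ofReal_mul (Real.exp_pos _).le,
          ← Real.exp_nat_mul, ← Real.exp_add]
        rw [← ENNReal.ofReal_one]
        refine ENNReal.ofReal_le_ofReal (Real.one_le_exp ?_)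
        have : ((Finset.univ.filter fun j => g j ∈ S).card : ℝ) ≤ k := by
          exact_mod_cast (show _ < k from hg).le
        linarith
    _ = ENNReal.ofReal (Real.exp k) * ∏ _j : ι, ∫⁻ x, F x ∂γ := by
        rw [lintegral_const_mul _ hPm, lintegral_prod_pi Finset.univ fun _ => hFm]
    _ ≤ ENNReal.ofReal (Real.exp k) * ∏ _j : ι, ENNReal.ofReal (Real.exp (-p / 2)) := by
        gcongr
    _ = _ := by
        rw [Finset.prod_const, ← ENNReal.ofReal_pow (Real.exp_pos _).le,
          ← ENNReal.ofReal_mul (Real.exp_pos _).le, ← Real.exp_nat_mul, ← Real.exp_add,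
          Finset.card_univ]
        congr 2; ring

variable {d : ℕ}

/-- Exponential moments of a signed sum, restricted to the event that its summands lie in a
slab. -/
theorem lintegral_exp_signedSum_slab_le {ι : Type*} [Fintype ι] [DecidableEq ι] (J A : Finset ι)
    {v : EuclideanSpace ℝ (Fin d)} (hv : ‖v‖ = 1) (w : EuclideanSpace ℝ (Fin d)) (η : ℝ) :
    ∫⁻ g, ENNReal.ofReal (Real.exp (inner ℝ w (signedSum J A g))) *
        ∏ j ∈ J, {x : EuclideanSpace ℝ (Fin d) | |inner ℝ v x| ≤ η}.indicator 1 (g j)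
        ∂(Measure.pi fun _ : ι => stdGaussian (EuclideanSpace ℝ (Fin d))) ≤
      (ENNReal.ofReal (Real.exp (‖w‖ ^ 2 / 2)) * ENNReal.ofReal η) ^ J.card := by
  -- The exponential of the signed sum is a product of tilts by `± w`.
  set ε : ι → ℝ := fun j => if j ∈ A then 1 else -1 with hε
  have hm : MeasurableSet {x : EuclideanSpace ℝ (Fin d) | |inner ℝ v x| ≤ η} :=
    measurableSet_le (by fun_prop) (by fun_prop)
  have h1 : ∀ g : ι → EuclideanSpace ℝ (Fin d),
      ENNReal.ofReal (Real.exp (inner ℝ w (signedSum J A g))) *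
        ∏ j ∈ J, {x : EuclideanSpace ℝ (Fin d) | |inner ℝ v x| ≤ η}.indicator 1 (g j) =
      ∏ j ∈ J, (fun j x => ENNReal.ofReal (Real.exp (inner ℝ (ε j • w) x)) *
        {x : EuclideanSpace ℝ (Fin d) | |inner ℝ v x| ≤ η}.indicator 1 x) j (g j) := by
    intro g
    simp only
    rw [Finset.prod_mul_distrib, ← ENNReal.ofReal_prod_of_nonneg fun _ _ => (Real.exp_pos _).le,
      ← Real.exp_sum, signedSum, inner_sum]
    congr 3
    refine Finset.sum_congr rfl fun j _ => ?_
    rw [inner_smul_right, real_inner_smul_left]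
  refine (lintegral_congr h1).trans_le ((lintegral_prod_pi J fun j =>
    (by fun_prop : Measurable fun x : EuclideanSpace ℝ (Fin d) =>
      ENNReal.ofReal (Real.exp (inner ℝ (ε j • w) x))).mul (measurable_one.indicator hm)).trans_le ?_)
  refine Finset.prod_le_pow_card _ _ _ fun j _ => ?_
  refine (lintegral_exp_inner_slab_le hv (ε j • w) η).trans (le_of_eq ?_)
  have : ‖ε j • w‖ = ‖w‖ := by
    rw [norm_smul]
    simp only [hε]
    split_ifs <;> simp
  rw [this]

/-- The vector with coordinates in `{-1, 0, 1}` given by `σ`. -/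
noncomputable def signVec (σ : Fin d → SignType) : EuclideanSpace ℝ (Fin d) :=
  WithLp.toLp 2 fun i => (σ i : ℝ)

/-- The exponential of the total excess of `|h i|` over `t` is dominated by a sum of
exponentials of linear functionals, by expanding the product over `i` of
`1 + exp (l * (h i - t)) + exp (l * (-h i - t))`. -/
theorem exp_excess_le (l t : ℝ) (h : EuclideanSpace ℝ (Fin d)) :
    Real.exp (l * ∑ i, max (|h i| - t) 0) ≤
      ∑ σ : Fin d → SignType, (∏ i, Real.exp (-(l * t)) ^ (σ i : ℤ).natAbs) *
        Real.exp (inner ℝ (l • signVec σ) h) := by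
  have h1 : ∀ r : ℝ, Real.exp (l * max (|r| - t) 0) ≤
      ∑ τ : SignType, Real.exp (-(l * t)) ^ (τ : ℤ).natAbs * Real.exp (l * τ * r) := by
    intro r
    have hsum : ∑ τ : SignType, Real.exp (-(l * t)) ^ (τ : ℤ).natAbs * Real.exp (l * τ * r) =
        1 + Real.exp (l * (-r - t)) + Real.exp (l * (r - t)) := by
      rw [SignType.univ_eq]
      simp only [Finset.sum_insert, Finset.sum_singleton, Finset.mem_insert, Finset.mem_singleton,
        reduceCtorEq, or_self, not_false_eq_true]
      simp [← Real.exp_add]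
      ring_nf
    rw [hsum]
    have e1 := Real.exp_pos (l * (-r - t))
    have e2 := Real.exp_pos (l * (r - t))
    rcases max_cases (|r| - t) 0 with ⟨h, _⟩ | ⟨h, _⟩
    · rw [h]
      rcases abs_cases r with ⟨h, _⟩ | ⟨h, _⟩ <;> rw [h] <;> linarith
    · rw [h, mul_zero, Real.exp_zero]; linarith
  calc Real.exp (l * ∑ i, max (|h i| - t) 0)
      = ∏ i, Real.exp (l * max (|h i| - t) 0) := by rw [← Real.exp_sum, Finset.mul_sum]
    _ ≤ ∏ i, ∑ τ : SignType, Real.exp (-(l * t)) ^ (τ : ℤ).natAbs * Real.exp (l * τ * h i) :=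
        Finset.prod_le_prod (fun _ _ => (Real.exp_pos _).le) fun i _ => h1 _
    _ = _ := by
        rw [Finset.prod_univ_sum, Fintype.piFinset_univ]
        refine Finset.sum_congr rfl fun σ _ => ?_
        rw [Finset.prod_mul_distrib, ← Real.exp_sum]
        congr 2
        simp [PiLp.inner_apply, signVec]
        exact Finset.sum_congr rfl fun i _ => by ring

theorem norm_sq_signVec (σ : Fin d → SignType) :
    ‖signVec σ‖ ^ 2 = ∑ i, ((σ i : ℤ).natAbs : ℝ) := by
  rw [EuclideanSpace.real_norm_sq_eq]
  refine Finset.sum_congr rfl fun i _ => ?_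
  simp only [signVec]
  cases σ i <;> simp

/-- The event that all `g j` with `j ∈ J` lie in the slab of half-width `η` orthogonal to `v`,
while the coordinates of the signed sum exceed the level `t` by at least `R` in total. -/
def slabExcess {ι : Type*} [DecidableEq ι] (v : EuclideanSpace ℝ (Fin d)) (η t R : ℝ)
    (J A : Finset ι) : Set (ι → EuclideanSpace ℝ (Fin d)) :=
  {g | (∀ j ∈ J, |inner ℝ v (g j)| ≤ η) ∧ R ≤ ∑ i, max (|signedSum J A g i| - t) 0}

/-- Markov's inequality for the exponential of `t / |J|` times the excess; this rate
minimizes the Gaussian exponent `-l * t + |J| * l ^ 2 / 2` of each coordinate. -/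
theorem measure_slabExcess_le {ι : Type*} [Fintype ι] [DecidableEq ι] (J A : Finset ι)
    {v : EuclideanSpace ℝ (Fin d)} (hv : ‖v‖ = 1) {η t R : ℝ} (hη : 0 ≤ η) (ht : 0 ≤ t)
    (hJ : J.Nonempty) :
    (Measure.pi fun _ : ι => stdGaussian (EuclideanSpace ℝ (Fin d))) (slabExcess v η t R J A) ≤
      ENNReal.ofReal (η ^ J.card * Real.exp (-(t / J.card * R) +
        2 * d * Real.exp (-(t ^ 2 / (2 * J.card))))) := by
  set k := J.card with hk
  have hk0 : 0 < (k : ℝ) := by exact_mod_cast hJ.card_pos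
  set l := t / k with hl
  have hl0 : 0 ≤ l := by positivity
  have hm : MeasurableSet {x : EuclideanSpace ℝ (Fin d) | |inner ℝ v x| ≤ η} :=
    measurableSet_le (by fun_prop) (by fun_prop)
  set W : (Fin d → SignType) → ℝ := fun σ => ∏ i, Real.exp (-(l * t)) ^ (σ i : ℤ).natAbs with hW
  have hW0 : ∀ σ, 0 ≤ W σ := fun σ => Finset.prod_nonneg fun _ _ => by positivity
  set S : (ι → EuclideanSpace ℝ (Fin d)) → ENNReal := fun g =>
    ∏ j ∈ J, {x : EuclideanSpace ℝ (Fin d) | |inner ℝ v x| ≤ η}.indicator 1 (g j) with hS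
  have hSm : Measurable S := Finset.measurable_prod _ fun j _ =>
    (measurable_one.indicator hm).comp (measurable_pi_apply j)
  have hsm : Measurable fun g : ι → EuclideanSpace ℝ (Fin d) => signedSum J A g := by
    unfold signedSum; fun_prop
  have hterm : ∀ σ, Measurable fun g : ι → EuclideanSpace ℝ (Fin d) =>
      ENNReal.ofReal (W σ) * (ENNReal.ofReal (Real.exp (inner ℝ (l • signVec σ)
        (signedSum J A g))) * S g) := fun σ => by fun_prop
  calc (Measure.pi fun _ : ι => stdGaussian (EuclideanSpace ℝ (Fin d))) (slabExcess v η t R J A)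
      ≤ ∫⁻ g, ENNReal.ofReal (Real.exp (-(l * R))) * ∑ σ, ENNReal.ofReal (W σ) *
          (ENNReal.ofReal (Real.exp (inner ℝ (l • signVec σ) (signedSum J A g))) * S g)
          ∂(Measure.pi fun _ : ι => stdGaussian (EuclideanSpace ℝ (Fin d))) := by
        refine measure_le_lintegral_of_one_le (by fun_prop) fun g hg => ?_
        have hS1 : S g = 1 := Finset.prod_eq_one fun j hj => by
          have hj' : g j ∈ {x : EuclideanSpace ℝ (Fin d) | |inner ℝ v x| ≤ η} := hg.1 j hj
          rw [Set.indicator_of_mem hj', Pi.one_apply]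
        simp_rw [hS1, mul_one, ← ENNReal.ofReal_mul (hW0 _)]
        rw [← ENNReal.ofReal_sum_of_nonneg fun σ _ => mul_nonneg (hW0 σ) (Real.exp_pos _).le,
          ← ENNReal.ofReal_mul (Real.exp_pos _).le, ← ENNReal.ofReal_one]
        refine ENNReal.ofReal_le_ofReal ?_
        calc (1 : ℝ) ≤ Real.exp (-(l * R)) *
              Real.exp (l * ∑ i, max (|signedSum J A g i| - t) 0) := by
              rw [← Real.exp_add]
              refine Real.one_le_exp ?_
              have := mul_le_mul_of_nonneg_left hg.2 hl0
              linarith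
          _ ≤ _ := by
              gcongr
              exact exp_excess_le l t _
    _ = ENNReal.ofReal (Real.exp (-(l * R))) * ∑ σ, ENNReal.ofReal (W σ) *
          ∫⁻ g, ENNReal.ofReal (Real.exp (inner ℝ (l • signVec σ) (signedSum J A g))) * S g
          ∂(Measure.pi fun _ : ι => stdGaussian (EuclideanSpace ℝ (Fin d))) := by
        rw [lintegral_const_mul _ (Finset.measurable_fun_sum _ fun σ _ => hterm σ),
          lintegral_finsetSum _ fun σ _ => hterm σ]
        congr 1
        exact Finset.sum_congr rfl fun σ _ => lintegral_const_mul _ (by fun_prop)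
    _ ≤ ENNReal.ofReal (Real.exp (-(l * R))) * ∑ σ, ENNReal.ofReal (W σ) *
          (ENNReal.ofReal (Real.exp (‖l • signVec σ‖ ^ 2 / 2)) * ENNReal.ofReal η) ^ k := by
        gcongr with σ _
        exact lintegral_exp_signedSum_slab_le J A hv _ η
    _ = ENNReal.ofReal (Real.exp (-(l * R)) * ∑ σ, W σ *
          (Real.exp (‖l • signVec σ‖ ^ 2 / 2) * η) ^ k) := by
        rw [ENNReal.ofReal_mul (Real.exp_pos _).le, ENNReal.ofReal_sum_of_nonneg fun σ _ =>
          mul_nonneg (hW0 σ) (by positivity)]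
        congr 1
        refine Finset.sum_congr rfl fun σ _ => ?_
        rw [ENNReal.ofReal_mul (hW0 σ), ENNReal.ofReal_pow (by positivity),
          ENNReal.ofReal_mul (Real.exp_pos _).le]
    _ ≤ _ := by
        refine ENNReal.ofReal_le_ofReal ?_
        set q := Real.exp (-(t ^ 2 / (2 * k))) with hq
        have hσ : ∀ σ : Fin d → SignType, W σ * (Real.exp (‖l • signVec σ‖ ^ 2 / 2) * η) ^ k =
            η ^ k * ∏ i, q ^ (σ i : ℤ).natAbs := by
          intro σ
          rw [mul_pow, mul_comm (η ^ k), ← mul_assoc]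
          congr 1
          rw [norm_smul, mul_pow, norm_sq_signVec, hW, hq]
          simp_rw [← Real.exp_nat_mul]
          rw [← Real.exp_sum, ← Real.exp_sum, ← Real.exp_add, ← Finset.sum_mul, ← Finset.sum_mul]
          congr 1
          rw [Real.norm_eq_abs, sq_abs, hl]
          field_simp
          ring
        simp_rw [hσ]
        rw [← Finset.mul_sum]
        have hprod : ∑ σ : Fin d → SignType, ∏ i, q ^ (σ i : ℤ).natAbs = (1 + 2 * q) ^ d := by
          rw [← Fintype.piFinset_univ,
            ← Finset.prod_univ_sum (fun _ : Fin d => (Finset.univ : Finset SignType))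
              fun _ τ => q ^ (τ : ℤ).natAbs, Finset.prod_const, Finset.card_univ, Fintype.card_fin]
          congr 1
          rw [SignType.univ_eq]
          simp only [Finset.sum_insert, Finset.sum_singleton, Finset.mem_insert,
            Finset.mem_singleton, reduceCtorEq, or_self, not_false_eq_true]
          simp
          ring
        rw [hprod, Real.exp_add, mul_left_comm]
        gcongr
        calc (1 + 2 * q) ^ d ≤ Real.exp (2 * q) ^ d := by
              gcongr; linarith [Real.add_one_le_exp (2 * q)]
          _ = _ := by rw [← Real.exp_nat_mul]; ring_nf

end Deviation

/-! ### Union bounds -/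

/-- For one pair of cell representatives: either few of the `g j` separate them robustly, or
some set of exactly `k` such indices, with some choice of signs, has a large excess. -/
theorem measure_pair_not_separated_le {n : ℕ} (hn : 1 ≤ n) {ι : Type*} [Fintype ι] [DecidableEq ι]
    {s δ a t : ℝ} {k : ℕ} {x₀ y₀ : USphere n}
    (hx₀ : x₀ ∈ convSparse n s) (hy₀ : y₀ ∈ convSparse n s)
    (hxy : δ ≤ ‖(x₀ : EuclideanSpace ℝ (Fin (n + 1))) - y₀‖) (hδ : 0 < δ) (hδ1 : δ ≤ 1)
    (ha : 0 < a) (hk : 0 < k) (ht : 0 ≤ t) (htk : 2 * √s * t ≤ k * δ / 32) :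
    (Measure.pi fun _ : ι => stdGaussian (EuclideanSpace ℝ (Fin (n + 1))))
      {g | ∃ x ∈ convSparse n s, ∃ y ∈ convSparse n s,
        (∀ i, |((x : EuclideanSpace ℝ (Fin (n + 1))) - x₀) i| ≤ a) ∧
        (∀ i, |((y : EuclideanSpace ℝ (Fin (n + 1))) - y₀) i| ≤ a) ∧
        ∀ j, 0 ≤ inner ℝ (x : EuclideanSpace ℝ (Fin (n + 1))) (g j) *
          inner ℝ (y : EuclideanSpace ℝ (Fin (n + 1))) (g j)} ≤
      ENNReal.ofReal (Real.exp (k - δ * Fintype.card ι / 64)) +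
      ENNReal.ofReal ((Fintype.card ι).choose k * 2 ^ k * ((δ / 8) ^ k *
        Real.exp (-(t / k * (k * δ / 32 / a)) +
          2 * (n + 1 : ℕ) * Real.exp (-(t ^ 2 / (2 * k)))))) := by
  classical
  have hx1 : ‖(x₀ : EuclideanSpace ℝ (Fin (n + 1)))‖ = 1 := by simp
  have hy1 : ‖(y₀ : EuclideanSpace ℝ (Fin (n + 1)))‖ = 1 := by simp
  have hne : (x₀ : EuclideanSpace ℝ (Fin (n + 1))) ≠ y₀ := by
    intro h
    rw [h, sub_self, norm_zero] at hxy
    linarith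
  obtain ⟨u, v, hu, hv, huv, hpu, hqv⟩ :=
    exists_orthonormal_chord_frame (by simp; omega) hx1 hy1 hne
  set T : Set (EuclideanSpace ℝ (Fin (n + 1))) :=
    {x | |inner ℝ v x| ≤ δ / 8 ∧ 1 / 2 ≤ |inner ℝ u x|} with hT
  have hTm : MeasurableSet T :=
    (measurableSet_le (f := fun x => |inner ℝ v x|) (by fun_prop) (by fun_prop)).inter
      (measurableSet_le (g := fun x => |inner ℝ u x|) (by fun_prop) (by fun_prop))
  set P := (Finset.powersetCard k (Finset.univ : Finset ι)).sigma fun J => J.powerset with hP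
  have hPcard : P.card = (Fintype.card ι).choose k * 2 ^ k := by
    rw [hP, Finset.card_sigma, Finset.sum_congr rfl fun J hJ => by
      rw [Finset.card_powerset, (Finset.mem_powersetCard.1 hJ).2], Finset.sum_const,
      Finset.card_powersetCard, smul_eq_mul, Finset.card_univ]
  have hsub : {g : ι → EuclideanSpace ℝ (Fin (n + 1)) |
        ∃ x ∈ convSparse n s, ∃ y ∈ convSparse n s,
        (∀ i, |((x : EuclideanSpace ℝ (Fin (n + 1))) - x₀) i| ≤ a) ∧
        (∀ i, |((y : EuclideanSpace ℝ (Fin (n + 1))) - y₀) i| ≤ a) ∧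
        ∀ j, 0 ≤ inner ℝ (x : EuclideanSpace ℝ (Fin (n + 1))) (g j) *
          inner ℝ (y : EuclideanSpace ℝ (Fin (n + 1))) (g j)} ⊆
      {g | (Finset.univ.filter fun j => g j ∈ T).card < k} ∪
        ⋃ p ∈ P, slabExcess v (δ / 8) t (k * δ / 32 / a) p.1 p.2 := by
    rintro g ⟨x, hx, y, hy, hxa, hya, hg⟩
    by_cases hc : (Finset.univ.filter fun j => g j ∈ T).card < k
    · exact Or.inl hc
    · right
      obtain ⟨J, hJT, hJk⟩ := Finset.exists_subset_card_eq (not_lt.1 hc)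
      have hJ : ∀ j ∈ J, g j ∈ T := fun j hj => (Finset.mem_filter.1 (hJT hj)).2
      obtain ⟨A, hA, hle⟩ := exists_excess_of_not_separated hx1 hy1 hpu hqv hxy hJ hg
        hxa (sum_abs_sub_le hx hx₀) hya (sum_abs_sub_le hy hy₀) ht (hJk ▸ htk)
      refine Set.mem_iUnion₂.2 ⟨⟨J, A⟩, ?_, ?_⟩
      · simp only [hP, Finset.mem_sigma, Finset.mem_powersetCard_univ, Finset.mem_powerset]
        exact ⟨hJk, hA⟩
      · refine ⟨fun j hj => (hJ j hj).1, ?_⟩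
        rw [div_le_iff₀' ha, ← hJk]
        exact hle
  refine (measure_mono hsub).trans ((measure_union_le _ _).trans (add_le_add ?_ ?_))
  · have hp : ENNReal.ofReal (δ / 32) ≤ stdGaussian (EuclideanSpace ℝ (Fin (n + 1))) T := by
      have := le_stdGaussian_slab hu hv huv (η := δ / 8) (by linarith) (by linarith)
      rwa [show δ / 8 / 4 = δ / 32 by ring] at this
    refine (measure_card_lt_le hTm hp k).trans (le_of_eq ?_)
    congr 3; ring
  · refine (measure_biUnion_finset_le _ _).trans ?_
    refine (Finset.sum_le_card_nsmul P _ (ENNReal.ofReal ((δ / 8) ^ k *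
        Real.exp (-(t / k * (k * δ / 32 / a)) +
          2 * (n + 1 : ℕ) * Real.exp (-(t ^ 2 / (2 * k)))))) fun p hp => ?_).trans ?_
    · have hpk : p.1.card = k :=
        (Finset.mem_powersetCard.1 (Finset.mem_sigma.1 hp).1).2
      have hne : p.1.Nonempty := Finset.card_pos.1 (hpk ▸ hk)
      have := measure_slabExcess_le (R := k * δ / 32 / a) p.1 p.2 hv
        (by positivity : 0 ≤ δ / 8) ht hne
      rwa [hpk] at this
    · rw [hPcard, nsmul_eq_mul, ← ENNReal.ofReal_natCast, ← ENNReal.ofReal_mul (by positivity)]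
      push_cast
      exact le_rfl

/-- The tuples `θ` for which two points of the convex sparse vectors at chordal distance at
least `2 δ` are strictly separated by no `θ j`. The weak inequality `0 ≤ ⟪x, θ j⟫ * ⟪y, θ j⟫`, rather
than equality of signs, makes this set closed. -/
def notSeparated (n m : ℕ) (s δ : ℝ) : Set (Fin m → USphere n) :=
  {θ | ∃ x ∈ convSparse n s, ∃ y ∈ convSparse n s,
    2 * δ ≤ ‖(x : EuclideanSpace ℝ (Fin (n + 1))) - y‖ ∧
    ∀ j, 0 ≤ inner ℝ (x : EuclideanSpace ℝ (Fin (n + 1))) (θ j) *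
      inner ℝ (y : EuclideanSpace ℝ (Fin (n + 1))) (θ j)}

theorem isClosed_convSparse (n : ℕ) (s : ℝ) : IsClosed (convSparse n s) :=
  isClosed_le (by fun_prop) continuous_const

/-- The set is the projection of a compact set. -/
theorem measurableSet_notSeparated (n m : ℕ) (s δ : ℝ) :
    MeasurableSet (notSeparated n m s δ) := by
  set C : Set ((Fin m → USphere n) × USphere n × USphere n) :=
    {p | p.2.1 ∈ convSparse n s ∧ p.2.2 ∈ convSparse n s ∧
      2 * δ ≤ ‖(p.2.1 : EuclideanSpace ℝ (Fin (n + 1))) - p.2.2‖ ∧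
      ∀ j, 0 ≤ inner ℝ (p.2.1 : EuclideanSpace ℝ (Fin (n + 1))) (p.1 j) *
        inner ℝ (p.2.2 : EuclideanSpace ℝ (Fin (n + 1))) (p.1 j)} with hC
  have hclosed : IsClosed C := by
    have hdist : IsClosed {p : (Fin m → USphere n) × USphere n × USphere n |
        2 * δ ≤ ‖(p.2.1 : EuclideanSpace ℝ (Fin (n + 1))) - p.2.2‖} :=
      isClosed_le (by fun_prop) (by fun_prop)
    refine ((isClosed_convSparse n s).preimage (by fun_prop)).inter
      (((isClosed_convSparse n s).preimage (by fun_prop)).inter (hdist.inter ?_))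
    have : {p : (Fin m → USphere n) × USphere n × USphere n |
        ∀ j, 0 ≤ inner ℝ (p.2.1 : EuclideanSpace ℝ (Fin (n + 1))) (p.1 j) *
        inner ℝ (p.2.2 : EuclideanSpace ℝ (Fin (n + 1))) (p.1 j)} =
        ⋂ j, {p | 0 ≤ inner ℝ (p.2.1 : EuclideanSpace ℝ (Fin (n + 1))) (p.1 j) *
        inner ℝ (p.2.2 : EuclideanSpace ℝ (Fin (n + 1))) (p.1 j)} := by
      ext; simp
    change IsClosed {p : (Fin m → USphere n) × USphere n × USphere n |
        ∀ j, 0 ≤ inner ℝ (p.2.1 : EuclideanSpace ℝ (Fin (n + 1))) (p.1 j) *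
        inner ℝ (p.2.2 : EuclideanSpace ℝ (Fin (n + 1))) (p.1 j)}
    rw [this]
    exact isClosed_iInter fun j => isClosed_le (by fun_prop) (by fun_prop)
  have himg : notSeparated n m s δ = Prod.fst '' C := by
    ext θ
    constructor
    · rintro ⟨x, hx, y, hy, h⟩
      exact ⟨(θ, x, y), ⟨hx, hy, h⟩, rfl⟩
    · rintro ⟨⟨_, x, y⟩, ⟨hx, hy, h⟩, rfl⟩
      exact ⟨x, hx, y, hy, h⟩
  rw [himg]
  exact (hclosed.isCompact.image continuous_fst).isClosed.measurableSet

theorem hasSmallCells_of_notMem {n m : ℕ} {s δ : ℝ} {θ : Fin m → USphere n}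
    (h : θ ∉ notSeparated n m s δ) : HasSmallCells (convSparse n s) θ δ := by
  intro x hx y hy hsgn
  by_contra! hd
  refine h ⟨x, hx, y, hy, (by linarith [two_mul_geoDist_le x y]), fun j => ?_⟩
  have hj := hsgn j
  unfold oneBit at hj
  split_ifs at hj with h1 h2 h2
  · exact mul_nonneg h1 h2
  · exact mul_nonneg_of_nonpos_of_nonpos (not_le.1 h1).le (not_le.1 h2).le

theorem pi_sphereUniform_eq_map (n m : ℕ) :
    (Measure.pi fun _ : Fin m => sphereUniform n) =
      (Measure.pi fun _ : Fin m => stdGaussian (EuclideanSpace ℝ (Fin (n + 1)))).map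
        fun g j => direction (g j) := by
  have : IsProbabilityMeasure ((stdGaussian (EuclideanSpace ℝ (Fin (n + 1)))).map direction) :=
    Measure.isProbabilityMeasure_map measurable_direction.aemeasurable
  rw [Measure.pi_map_pi fun _ => measurable_direction.aemeasurable]
  simp_rw [map_direction_stdGaussian]

/-- The union bound over pairs of cell representatives at distance at least `δ`, with
Gaussian vectors in place of uniform ones: only their directions matter. -/
theorem measure_notSeparated_le {n m : ℕ} (hn : 1 ≤ n) {s δ a t : ℝ} {k : ℕ}
    (hδ : 0 < δ) (hδ1 : δ ≤ 1) (ha : 0 < a) (hk : 0 < k) (ht : 0 ≤ t)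
    (htk : 2 * √s * t ≤ k * δ / 32) (has : a * (2 * √s) ≤ (δ / 2) ^ 2)
    {X : Finset (USphere n)} (hXK : ∀ x ∈ X, x ∈ convSparse n s)
    (hX : ∀ x ∈ convSparse n s, ∃ x₀ ∈ X, ∀ i,
      |(x : EuclideanSpace ℝ (Fin (n + 1))) i - (x₀ : EuclideanSpace ℝ (Fin (n + 1))) i| ≤ a) :
    (Measure.pi fun _ : Fin m => sphereUniform n) (notSeparated n m s δ) ≤
      X.card ^ 2 * (ENNReal.ofReal (Real.exp (k - δ * m / 64)) +
      ENNReal.ofReal (m.choose k * 2 ^ k * ((δ / 8) ^ k *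
        Real.exp (-(t / k * (k * δ / 32 / a)) +
          2 * (n + 1 : ℕ) * Real.exp (-(t ^ 2 / (2 * k))))))) := by
  set Pr := (X ×ˢ X).filter fun p =>
    δ ≤ ‖(p.1 : EuclideanSpace ℝ (Fin (n + 1))) - p.2‖ with hPr
  have hclose : ∀ x ∈ convSparse n s, ∀ x₀ ∈ convSparse n s,
      (∀ i, |((x : EuclideanSpace ℝ (Fin (n + 1))) - x₀) i| ≤ a) →
      ‖(x : EuclideanSpace ℝ (Fin (n + 1))) - x₀‖ ≤ δ / 2 := by
    intro x hx x₀ hx₀ h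
    refine abs_le_of_sq_le_sq' ?_ (by linarith) |>.2
    exact (sq_norm_le_of_abs_le h (sum_abs_sub_le hx hx₀) ha.le).trans has
  have hdm : Measurable fun (g : Fin m → EuclideanSpace ℝ (Fin (n + 1))) j => direction (g j) :=
    measurable_pi_iff.2 fun j => measurable_direction.comp (measurable_pi_apply j)
  rw [pi_sphereUniform_eq_map, Measure.map_apply hdm
    (measurableSet_notSeparated n m s δ)]
  have hsub : (fun (g : Fin m → EuclideanSpace ℝ (Fin (n + 1))) j => direction (g j)) ⁻¹'
      notSeparated n m s δ ⊆ ⋃ p ∈ Pr, {g | ∃ x ∈ convSparse n s, ∃ y ∈ convSparse n s,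
        (∀ i, |((x : EuclideanSpace ℝ (Fin (n + 1))) - p.1) i| ≤ a) ∧
        (∀ i, |((y : EuclideanSpace ℝ (Fin (n + 1))) - p.2) i| ≤ a) ∧
        ∀ j, 0 ≤ inner ℝ (x : EuclideanSpace ℝ (Fin (n + 1))) (g j) *
          inner ℝ (y : EuclideanSpace ℝ (Fin (n + 1))) (g j)} := by
    rintro g ⟨x, hx, y, hy, hxy, hg⟩
    obtain ⟨x₀, hx₀, hxa⟩ := hX x hx
    obtain ⟨y₀, hy₀, hya⟩ := hX y hy
    refine Set.mem_iUnion₂.2 ⟨(x₀, y₀), ?_, x, hx, y, hy, hxa, hya, fun j => ?_⟩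
    · refine Finset.mem_filter.2 ⟨Finset.mk_mem_product hx₀ hy₀, ?_⟩
      have h1 := hclose x hx x₀ (hXK _ hx₀) hxa
      have h2 := hclose y hy y₀ (hXK _ hy₀) hya
      have h3 : ‖(x : EuclideanSpace ℝ (Fin (n + 1))) - y‖ ≤
          ‖(x : EuclideanSpace ℝ (Fin (n + 1))) - x₀‖ +
          ‖(x₀ : EuclideanSpace ℝ (Fin (n + 1))) - y₀‖ +
          ‖(y : EuclideanSpace ℝ (Fin (n + 1))) - y₀‖ := by
        rw [norm_sub_rev (y : EuclideanSpace ℝ (Fin (n + 1))) y₀]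
        refine le_trans (le_of_eq ?_) (norm_add₃_le)
        congr 1; abel
      simp only
      linarith
    -- The sign condition is unaffected by scaling, and trivial for `g j = 0`.
    · by_cases h0 : g j = 0
      · simp [h0]
      · have := hg j
        rw [coe_direction h0, inner_smul_right, inner_smul_right] at this
        have hpos : 0 < ‖g j‖⁻¹ := inv_pos.2 (norm_pos_iff.2 h0)
        rw [mul_mul_mul_comm] at this
        exact nonneg_of_mul_nonneg_right this (mul_pos hpos hpos)
  refine (measure_mono hsub).trans ((measure_biUnion_finset_le _ _).trans ?_)
  refine (Finset.sum_le_card_nsmul Pr _ (ENNReal.ofReal (Real.exp (k - δ * m / 64)) +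
      ENNReal.ofReal (m.choose k * 2 ^ k * ((δ / 8) ^ k *
        Real.exp (-(t / k * (k * δ / 32 / a)) +
          2 * (n + 1 : ℕ) * Real.exp (-(t ^ 2 / (2 * k))))))) fun p hp => ?_).trans ?_
  · obtain ⟨hp1, hp2⟩ := Finset.mem_filter.1 hp
    obtain ⟨hpx, hpy⟩ := Finset.mem_product.1 hp1
    have := measure_pair_not_separated_le (ι := Fin m) hn (hXK _ hpx) (hXK _ hpy) hp2 hδ hδ1 ha hk
      ht htk
    rwa [Fintype.card_fin] at this
  · rw [nsmul_eq_mul]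
    gcongr
    have : Pr.card ≤ X.card ^ 2 := by
      rw [sq, ← Finset.card_product]
      exact Finset.card_filter_le _ _
    exact_mod_cast this

theorem choose_mul_pow_le {m k : ℕ} {δ : ℝ} (hδ : 0 ≤ δ) (hk : 0 < k)
    (hm : δ * m ≤ 16384 * k) :
    (m.choose k : ℝ) * 2 ^ k * (δ / 8) ^ k ≤ Real.exp (13 * k) := by
  have hk0 : (0 : ℝ) < k := by exact_mod_cast hk
  have h1 : (m.choose k : ℝ) ≤ (m : ℝ) ^ k / k.factorial := Nat.choose_le_pow_div k m
  have h2 : (k : ℝ) ^ k / k.factorial ≤ Real.exp k := Real.pow_div_factorial_le_exp _ hk0.le k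
  have h3 : (m : ℝ) * 2 * (δ / 8) / k ≤ Real.exp 12 := by
    rw [div_le_iff₀ hk0]
    have h4 : (4096 : ℝ) ≤ Real.exp 12 := by
      have h5 : (2 : ℝ) ≤ Real.exp 1 := by linarith [Real.add_one_le_exp 1]
      calc (4096 : ℝ) = 2 ^ 12 := by norm_num
        _ ≤ Real.exp 1 ^ 12 := by gcongr
        _ = Real.exp 12 := by rw [← Real.exp_nat_mul]; norm_num
    nlinarith
  calc (m.choose k : ℝ) * 2 ^ k * (δ / 8) ^ k
      ≤ (m : ℝ) ^ k / k.factorial * 2 ^ k * (δ / 8) ^ k := by gcongr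
    _ = ((k : ℝ) ^ k / k.factorial) * (m * 2 * (δ / 8) / k) ^ k := by
        have : ((m : ℝ) * 2 * (δ / 8) / k) ^ k = m ^ k * 2 ^ k * (δ / 8) ^ k / k ^ k := by
          rw [div_pow, mul_pow, mul_pow]
        rw [this]
        field_simp
    _ ≤ Real.exp k * Real.exp 12 ^ k := by gcongr
    _ = Real.exp (13 * k) := by
        rw [← Real.exp_nat_mul, ← Real.exp_add]; ring_nf

/-! ### Choice of the constants -/

theorem one_le_logPlus (t : ℝ) : 1 ≤ logPlus t := le_max_left _ _

theorem exp_neg_logPlus_le {t : ℝ} (ht : 0 < t) : Real.exp (-logPlus t) ≤ t⁻¹ := by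
  rw [Real.exp_neg]
  refine inv_anti₀ ht ?_
  calc t = Real.exp (Real.log t) := (Real.exp_log ht).symm
    _ ≤ _ := Real.exp_le_exp.2 (le_max_right _ _)

theorem one_le_of_mem_convSparse {n : ℕ} {s : ℝ} {x : USphere n} (hx : x ∈ convSparse n s) :
    1 ≤ s := by
  have h1 : ‖(x : EuclideanSpace ℝ (Fin (n + 1)))‖ ^ 2 ≤ √s * √s := by
    refine sq_norm_le_of_abs_le (fun i => ?_) hx (Real.sqrt_nonneg _)
    exact (Finset.single_le_sum (f := fun i => |(x : EuclideanSpace ℝ (Fin (n + 1))) i|)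
      (fun _ _ => abs_nonneg _) (Finset.mem_univ i)).trans hx
  have hx1 : ‖(x : EuclideanSpace ℝ (Fin (n + 1)))‖ = 1 := by simp
  rw [hx1, one_pow] at h1
  rcases le_or_gt 0 s with h | h
  · rwa [Real.mul_self_sqrt h] at h1
  · rw [Real.sqrt_eq_zero_of_nonpos h.le] at h1
    linarith

theorem one_le_coverNum {n : ℕ} {K : Set (USphere n)} (hK : K.Nonempty) {r : ℝ} (hr : 0 < r) :
    1 ≤ coverNum K r := by
  obtain ⟨t, ht⟩ := exists_geoCover K hr
  obtain ⟨x, hx⟩ := hK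
  obtain ⟨t', hc, ht'⟩ := Nat.sInf_mem
    (s := {k : ℕ | ∃ t : Finset (USphere n), t.card = k ∧ ∀ x ∈ K, ∃ z ∈ t, geoDist z x ≤ r})
    ⟨_, t, rfl, ht⟩
  obtain ⟨z, hz, _⟩ := ht' x hx
  rw [coverNum, ← hc]
  exact Finset.card_pos.2 ⟨z, hz⟩

/-- The union bound over `X ^ 2` pairs against the allowed failure probability. -/
theorem sq_mul_exp_le_zpow {N X D : ℝ} (hN : 1 ≤ N) (hNX : N ≤ X)
    (hX : X ≤ Real.exp (3000000 * D)) (hD : 1 ≤ D) :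
    X ^ 2 * (Real.exp (-(13000000 * D)) + Real.exp (-(13000000 * D))) ≤ (2 * N) ^ (-2 : ℤ) := by
  have hX0 : 0 ≤ X := by linarith
  calc X ^ 2 * (Real.exp (-(13000000 * D)) + Real.exp (-(13000000 * D)))
      ≤ Real.exp (3000000 * D) ^ 2 *
        (Real.exp (-(13000000 * D)) + Real.exp (-(13000000 * D))) := by
        gcongr
    _ = 2 * Real.exp (-(7000000 * D)) := by
        rw [← Real.exp_nat_mul, ← two_mul, mul_left_comm, ← Real.exp_add]
        congr 2
        push_cast; ring
    _ ≤ (4 * Real.exp (6000000 * D))⁻¹ := by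
        rw [le_inv_comm₀ (by positivity) (by positivity), mul_inv, ← Real.exp_neg, neg_neg]
        have h1 : Real.exp (7000000 * D) = Real.exp (6000000 * D) * Real.exp (1000000 * D) := by
          rw [← Real.exp_add]; ring_nf
        have h2 := Real.add_one_le_exp (1000000 * D)
        rw [h1]
        nlinarith [Real.exp_pos (6000000 * D)]
    _ ≤ (2 * N) ^ (-2 : ℤ) := by
        rw [zpow_neg]
        refine inv_anti₀ (by positivity) ?_
        have h3 : N ^ 2 ≤ Real.exp (6000000 * D) := by
          calc N ^ 2 ≤ Real.exp (3000000 * D) ^ 2 := by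
                gcongr; exact hNX.trans hX
            _ = _ := by rw [← Real.exp_nat_mul]; congr 1; push_cast; ring
        calc (2 * N) ^ (2 : ℤ) = 4 * N ^ 2 := by
              rw [zpow_ofNat]; ring
          _ ≤ _ := by gcongr

/-- The failure probability when the number of vectors has exactly the order of magnitude
`D / δ`, where `D = s * logPlus (n / s) / δ ^ 2`. -/
theorem measure_notSeparated_le_coverNum {n m : ℕ} (hn : 1 ≤ n) {s δ : ℝ} (hs : 1 ≤ s)
    (hδ : 0 < δ) (hδ1 : δ < 1) (hK : (convSparse n s).Nonempty)
    (hm : 900000000 * (s * logPlus (n / s) / δ ^ 2) / δ ≤ m)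
    (hm' : m ≤ 1800000000 * (s * logPlus (n / s) / δ ^ 2) / δ) :
    (Measure.pi fun _ : Fin m => sphereUniform n) (notSeparated n m s δ) ≤
      ENNReal.ofReal ((2 * (coverNum (convSparse n s) (1 / 1000 * δ) : ℝ)) ^ (-2 : ℤ)) := by
  set L := logPlus (n / s) with hL
  set D := s * L / δ ^ 2 with hD
  have hs0 : 0 < s := by linarith
  have hn0 : (1 : ℝ) ≤ n := by exact_mod_cast hn
  have hL1 : 1 ≤ L := one_le_logPlus _
  have hLe : Real.exp (-L) ≤ s / n := by
    have := exp_neg_logPlus_le (t := n / s) (by positivity)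
    rwa [inv_div] at this
  have hδ2 : δ ^ 2 ≤ 1 := by nlinarith
  have hsD : s ≤ D := by
    rw [hD, le_div_iff₀ (by positivity)]
    calc s * δ ^ 2 ≤ s * 1 := by gcongr
      _ ≤ s * L := by gcongr
  have hD1 : 1 ≤ D := hs.trans hsD
  have hDδ : s * L = D * δ ^ 2 := by rw [hD]; field_simp
  -- `294912 = 768 ^ 2 / 2`: since `t * √s ≥ 768 * D * δ`, the excess bound gains the exponent
  -- `24 * 10 ^ 6 * D`, against `6 * 10 ^ 6 * D` for the pairs, as many for the allowed probability,
  -- and `13 * k` for the choice of the indices and signs.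
  set k := ⌈294912 * D⌉₊ with hk
  have hk1 : 294912 * D ≤ k := Nat.le_ceil _
  have hk2 : (k : ℝ) ≤ 589824 * D := by
    have := (Nat.ceil_lt_add_one (by positivity : 0 ≤ 294912 * D)).le
    linarith
  have hkpos : (0 : ℝ) < k := by linarith
  have hk0 : 0 < k := by exact_mod_cast hkpos
  -- With this level the Gaussian factor `exp (-t ^ 2 / (2 * k))` equals `exp (-L) ≤ s / n`.
  set t := √(2 * k * L) with ht
  have ht2 : t ^ 2 = 2 * k * L := Real.sq_sqrt (by positivity)
  have ht0 : 0 ≤ t := Real.sqrt_nonneg _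
  have hss : √s ^ 2 = s := Real.sq_sqrt hs0.le
  have hss0 : 0 < √s := Real.sqrt_pos.2 hs0
  set a := δ ^ 2 / 1000000 / √s with ha
  have ha0 : 0 < a := by positivity
  have has : a * (2 * √s) = δ ^ 2 / 500000 := by rw [ha]; field_simp; norm_num
  have hexp : Real.exp (-L) * (n + 1) ≤ 2 * D := by
    calc Real.exp (-L) * (n + 1) ≤ s / n * (2 * n) := by
          gcongr; linarith
      _ = 2 * s := by field_simp
      _ ≤ 2 * D := by linarith
  obtain ⟨X, hXK, hXcard, hX⟩ := exists_net_convSparse n s ha0 hL1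
  have hXc : (X.card : ℝ) ≤ Real.exp (3000000 * D) := by
    refine hXcard.trans (Real.exp_le_exp.2 ?_)
    have : L * (2 * √s / a) = 2000000 * D := by
      rw [ha, hD]
      field_simp
      rw [hss]
      ring
    rw [this]
    linarith
  have hcover : coverNum (convSparse n s) (1 / 1000 * δ) ≤ X.card := by
    refine coverNum_le_card fun x hx => ?_
    obtain ⟨z, hz, hxz⟩ := hX x hx
    refine ⟨z, hz, abs_le_of_sq_le_sq' ?_ (by linarith) |>.2⟩
    refine (sq_norm_le_of_abs_le hxz (sum_abs_sub_le hx (hXK z hz)) ha0.le).trans ?_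
    rw [has]
    nlinarith
  have hN1 : (1 : ℝ) ≤ coverNum (convSparse n s) (1 / 1000 * δ) := by
    exact_mod_cast one_le_coverNum hK (by positivity)
  have hNX : (coverNum (convSparse n s) (1 / 1000 * δ) : ℝ) ≤ X.card := by exact_mod_cast hcover
  set N : ℝ := (coverNum (convSparse n s) (1 / 1000 * δ) : ℝ) with hN
  have htk : 2 * √s * t ≤ k * δ / 32 := by
    refine abs_le_of_sq_le_sq' ?_ (by positivity) |>.2
    rw [mul_pow, mul_pow, hss, ht2]
    have h1 : 8 * k * (s * L) ≤ 8 * k * (k / 8192 * δ ^ 2) := by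
      rw [hDδ]
      gcongr
      linarith
    nlinarith
  have htail : 24000000 * D ≤ t / k * (k * δ / 32 / a) := by
    have h1 : 768 * D * δ ≤ t * √s := by
      refine abs_le_of_sq_le_sq' ?_ (by positivity) |>.2
      have h2 : (t * √s) ^ 2 = 2 * k * (D * δ ^ 2) := by
        rw [mul_pow, hss, ht2, ← hDδ]; ring
      have h3 : (768 * D * δ) ^ 2 = 2 * (294912 * D) * (D * δ ^ 2) := by ring
      rw [h2, h3]
      gcongr
    have h4 : t / k * (k * δ / 32 / a) = t * √s * (31250 / δ) := by
      rw [ha]; field_simp; ring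
    rw [h4]
    calc 24000000 * D = 768 * D * δ * (31250 / δ) := by field_simp; norm_num
      _ ≤ _ := by gcongr
  have hmlow : 900000000 * D ≤ δ * m := by
    rw [div_le_iff₀ hδ] at hm; linarith
  have hmup : δ * m ≤ 1800000000 * D := by
    rw [le_div_iff₀ hδ] at hm'; linarith
  have hfirst : Real.exp (k - δ * m / 64) ≤ Real.exp (-(13000000 * D)) := by
    gcongr; linarith
  have hsecond : (m.choose k : ℝ) * 2 ^ k * ((δ / 8) ^ k *
        Real.exp (-(t / k * (k * δ / 32 / a)) +
          2 * (n + 1 : ℕ) * Real.exp (-(t ^ 2 / (2 * k))))) ≤ Real.exp (-(13000000 * D)) := by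
    have hq : t ^ 2 / (2 * k) = L := by rw [ht2]; field_simp
    rw [← mul_assoc, hq]
    calc (m.choose k : ℝ) * 2 ^ k * (δ / 8) ^ k *
          Real.exp (-(t / k * (k * δ / 32 / a)) + 2 * (n + 1 : ℕ) * Real.exp (-L))
        ≤ Real.exp (13 * k) * Real.exp (-(24000000 * D) + 4 * D) := by
          gcongr ?_ * ?_
          · exact choose_mul_pow_le hδ.le hk0 (by linarith)
          · refine Real.exp_le_exp.2 ?_
            push_cast
            linarith
      _ ≤ _ := by
          rw [← Real.exp_add]
          gcongr
          linarith
  refine (measure_notSeparated_le hn hδ hδ1.le ha0 hk0 ht0 htk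
    (by rw [has]; nlinarith) hXK hX).trans ?_
  refine (mul_le_mul' le_rfl (add_le_add (ENNReal.ofReal_le_ofReal hfirst)
    (ENNReal.ofReal_le_ofReal hsecond))).trans ?_
  have hcast : (X.card : ENNReal) ^ 2 * (ENNReal.ofReal (Real.exp (-(13000000 * D))) +
      ENNReal.ofReal (Real.exp (-(13000000 * D)))) = ENNReal.ofReal ((X.card : ℝ) ^ 2 *
        (Real.exp (-(13000000 * D)) + Real.exp (-(13000000 * D)))) := by
    rw [ENNReal.ofReal_mul (sq_nonneg _), ENNReal.ofReal_pow (Nat.cast_nonneg _),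
      ENNReal.ofReal_natCast, ENNReal.ofReal_add (Real.exp_pos _).le (Real.exp_pos _).le]
  rw [hcast]
  refine ENNReal.ofReal_le_ofReal ?_
  exact sq_mul_exp_le_zpow hN1 hNX hXc hD1

theorem corollary1p2 :
    ∃ c C : ℝ, 0 < c ∧ c < 1 ∧ 1 < C ∧
      ∀ (n : ℕ) (s δ : ℝ), 0 < s → s < n + 1 → 0 < δ → δ < 1 →
      ∀ m : ℕ, C * δ ^ (-3 : ℤ) * s * logPlus (n / s) ≤ m →
      ∀ (Ω : Type*) [MeasurableSpace Ω] (P : Measure Ω) [IsProbabilityMeasure P]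
        (θ : Fin m → Ω → USphere n),
        iIndepFun θ P → (∀ j, HasLaw (θ j) (sphereUniform n) P) →
        ∃ E : Set Ω, MeasurableSet E ∧
          1 - (2 * (coverNum (convSparse n s) (c * δ) : ℝ)) ^ (-2 : ℤ) ≤ P.real E ∧
          ∀ ω ∈ E, HasSmallCells (convSparse n s) (fun j => θ j ω) δ := by
  refine ⟨1 / 1000, 900000000, by norm_num, by norm_num, by norm_num, ?_⟩
  intro n s δ hs hsn hδ hδ1 m hm Ω _ P _ θ hind hlaw
  -- If the set is empty, its covering number is `0` and `0 ^ (-2) = 0`: the event must be sure.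
  rcases (convSparse n s).eq_empty_or_nonempty with hK | hK
  · refine ⟨Set.univ, MeasurableSet.univ, ?_, fun ω _ x hx => by simp [hK] at hx⟩
    rw [probReal_univ]
    exact sub_le_self _ (by positivity)
  have hs1 : 1 ≤ s := one_le_of_mem_convSparse hK.some_mem
  have hn : 1 ≤ n := by
    by_contra! h
    have : n = 0 := by omega
    subst this
    norm_num at hsn
    linarith
  set D := s * logPlus (n / s) / δ ^ 2 with hD
  have hL1 : 1 ≤ logPlus (n / s) := one_le_logPlus _
  have hCD : (900000000 : ℝ) * δ ^ (-3 : ℤ) * s * logPlus (n / s) = 900000000 * D / δ := by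
    rw [hD, zpow_neg]
    norm_cast
    field_simp
  rw [hCD] at hm
  -- Only the first `m₀` vectors are used, so that the binomial coefficients in the union bound stay
  -- under control when `m` is much larger than required.
  set m₀ := ⌈900000000 * D / δ⌉₊ with hm₀
  have hle : m₀ ≤ m := Nat.ceil_le.2 hm
  have hbig : 1 ≤ 900000000 * D / δ := by
    have hδ2 : δ ^ 2 ≤ 1 := by nlinarith
    have : 1 ≤ D := by
      rw [hD, le_div_iff₀ (by positivity)]
      nlinarith
    rw [le_div_iff₀ hδ]
    nlinarith
  have hup : (m₀ : ℝ) ≤ 1800000000 * D / δ := by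
    have h1 := (Nat.ceil_lt_add_one (by linarith : 0 ≤ 900000000 * D / δ)).le
    have h2 : 1800000000 * D / δ = 900000000 * D / δ + 900000000 * D / δ := by ring
    rw [h2]
    linarith
  set Θ : Ω → Fin m₀ → USphere n := fun ω j => θ (Fin.castLE hle j) ω with hΘ
  have hΘlaw : HasLaw Θ (Measure.pi fun _ : Fin m₀ => sphereUniform n) P :=
    (hind.precomp (Fin.castLE_injective hle)).hasLaw_pi fun j => hlaw _
  -- The `θ j` are only almost everywhere measurable, so the preimage need not be measurable.
  set F := toMeasurable P (Θ ⁻¹' notSeparated n m₀ s δ) with hF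
  have hFm : MeasurableSet F := measurableSet_toMeasurable _ _
  have hPF : P F ≤ ENNReal.ofReal
      ((2 * (coverNum (convSparse n s) (1 / 1000 * δ) : ℝ)) ^ (-2 : ℤ)) := by
    rw [hF, measure_toMeasurable, ← Measure.map_apply_of_aemeasurable hΘlaw.aemeasurable
      (measurableSet_notSeparated n m₀ s δ), hΘlaw.map_eq]
    exact measure_notSeparated_le_coverNum hn hs1 hδ hδ1 hK (Nat.le_ceil _) hup
  refine ⟨Fᶜ, hFm.compl, ?_, fun ω hω => ?_⟩
  · rw [probReal_compl_eq_one_sub hFm]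
    refine sub_le_sub_left ?_ _
    exact ENNReal.toReal_le_of_le_ofReal (by positivity) hPF
  · have hnot : Θ ω ∉ notSeparated n m₀ s δ := fun h => hω (subset_toMeasurable _ _ h)
    intro x hx y hy hxy
    exact hasSmallCells_of_notMem hnot x hx y hy fun j => hxy (Fin.castLE hle j)
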